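/- Let $\mathbb{T}$ be the unit circle, let $\mathcal{C}^\infty(\mathbb{T})$ be the Fréchet space of smooth complex functions on $\mathbb{T}$, with the topology defined by the norms $\rho_\nu(f)=\sum_{n\in\mathbb{Z}}|\hat f(n)|(1+|n|)^\nu$ ($\nu\ge 0$ real), and let $\mathcal{D}'(\mathbb{T})$ be its topological dual, the space of distributions on $\mathbb{T}$. With $\alpha(z)=z$, put $\hat T(n)=\langle \alpha^{-n},T\rangle$ for $T\in\mathcal{D}'(\mathbb{T})$, $n\in\mathbb{Z}$. Let $a^\infty\subset\mathcal{C}^\infty(\mathbb{T})$ be the space of those smooth functions on $\mathbb{T}$ that extend to a continuous function on the closed unit disc which is holomorphic in the open disc. For a closed set $E\subset\mathbb{T}$ let $$I_\infty(E)=\{f\in\mathcal{C}^\infty(\mathbb{T}) : f^{(i)}=0 \text{ on } E \text{ for all } i\ge 0\},\qquad I_\infty^+(E)=I_\infty(E)\cap a^\infty,$$ where $f^{(i)}$ denotes the $i$-th derivative with respect to $z\in\mathbb{T}$. For a subspace $V$ of $\mathcal{C}^\infty(\mathbb{T})$ let $V^\perp$ be the set of distributions that vanish on $V$. Consider the following properties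 of $E$. (i) $E$ is an interpolation set for $a^\infty$: for every $f\in\mathcal{C}^\infty(\mathbb{T})$ there is $g\in a^\infty$ with $f^{(i)}=g^{(i)}$ on $E$ for all $i\ge 0$. (ii) $I_\infty^+(E)^\perp=I_\infty(E)^\perp+(a^\infty)^\perp$. (iii) For every real $s\ge 0$ there are constants $C>0$ and $t\ge 0$ such that $$\sup_{n\in\mathbb{Z}}\frac{|\hat T(n)|}{(1+|n|)^t}\le C\,\sup_{n\le 0}\frac{|\hat T(n)|}{(1+|n|)^s}\qquad\text{for all } T\in I_\infty(E)^\perp,$$ where the suprema are taken in $[0,+\infty]$. Then, for every closed set $E\subset\mathbb{T}$, (i) is equivalent to (iii), and (i) implies (ii). If moreover $E\ne\mathbb{T}$, then (ii) implies (i), so that the three properties are equivalent. -/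

import Mathlib

open Set MeasureTheory
open scoped Real NNReal ENNReal Manifold ContDiff

namespace CircleInterp

/-- The space of complex functions on the unit circle that are smooth on the manifold `Circle`. -/
def smoothSubmodule : Submodule ℂ (Circle → ℂ) where
  carrier := {f | ContMDiff (𝓡 1) 𝓘(ℝ, ℂ) ∞ f}
  add_mem' := fun hf hg => ContMDiff.add hf hg
  zero_mem' := contMDiff_const
  smul_mem' := fun c f hf => by
    have h : ContDiff ℝ ∞ (fun z : ℂ => c * z) := contDiff_const.mul contDiff_id
    exact h.contMDiff.comp hf

/-- The space `C^∞(𝕋)`. It is a type of its own, so that it does not inherit the topology of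
pointwise convergence; its Fréchet topology is given below. -/
def Smooth : Type := smoothSubmodule

namespace Smooth

noncomputable instance : AddCommGroup Smooth := inferInstanceAs (AddCommGroup smoothSubmodule)

noncomputable instance : Module ℂ Smooth := inferInstanceAs (Module ℂ smoothSubmodule)

instance : CoeFun Smooth (fun _ => Circle → ℂ) := ⟨fun f => f.1⟩

theorem ext {f g : Smooth} (h : ∀ z, f z = g z) : f = g := Subtype.ext (funext h)

theorem add_apply (f g : Smooth) (z : Circle) : (f + g) z = f z + g z := rfl

theorem smul_apply (c : ℂ) (f : Smooth) (z : Circle) : (c • f) z = c * f z := rfl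

theorem zero_apply (z : Circle) : (0 : Smooth) z = 0 := rfl

theorem contMDiff (f : Smooth) : ContMDiff (𝓡 1) 𝓘(ℝ, ℂ) ∞ (f : Circle → ℂ) := f.2

end Smooth

/-- A function on the circle is smooth iff it is a smooth function of the angle. -/
theorem contMDiff_iff_contDiff_exp (f : Circle → ℂ) :
    ContMDiff (𝓡 1) 𝓘(ℝ, ℂ) ∞ f ↔ ContDiff ℝ ∞ (fun t : ℝ => f (Circle.exp t)) := by
  constructor
  · intro h
    exact (h.comp contMDiff_circleExp).contDiff
  · intro h z₀
    obtain ⟨θ, hθ⟩ : ∃ θ : ℝ, Circle.exp θ = z₀ := ⟨_, Circle.exp_arg z₀⟩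
    let φ : ℂ → ℝ := fun w => θ + (Complex.log (w / (z₀ : ℂ))).im
    have hz₀ : (z₀ : ℂ) ≠ 0 := Circle.coe_ne_zero z₀
    have hφ : ContDiffAt ℝ ∞ φ (z₀ : ℂ) := by
      have h1 : ContDiffAt ℝ ∞ (fun w : ℂ => w / (z₀ : ℂ)) (z₀ : ℂ) :=
        contDiffAt_id.div_const _
      have h2 : ContDiffAt ℝ ∞ Complex.log ((z₀ : ℂ) / (z₀ : ℂ)) := by
        refine (Complex.contDiffAt_log ?_).restrict_scalars ℝ
        rw [div_self hz₀]; exact Complex.one_mem_slitPlane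
      have h3 : ContDiffAt ℝ ∞ (fun w : ℂ => Complex.log (w / (z₀ : ℂ))) (z₀ : ℂ) :=
        ContDiffAt.comp (g := Complex.log) (z₀ : ℂ) h2 h1
      have h4 : ContDiffAt ℝ ∞ (fun w : ℂ => (Complex.log (w / (z₀ : ℂ))).im) (z₀ : ℂ) :=
        Complex.imCLM.contDiff.contDiffAt.comp (z₀ : ℂ) h3
      exact contDiffAt_const.add h4
    have hc : ContMDiff (𝓡 1) 𝓘(ℝ, ℂ) ∞ (fun z : Circle => (z : ℂ)) :=
      haveI := Fact.mk Complex.finrank_real_complex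
      contMDiff_coe_sphere
    have hcomp : ContMDiffAt (𝓡 1) 𝓘(ℝ, ℂ) ∞
        (fun z : Circle => f (Circle.exp (φ (z : ℂ)))) z₀ :=
      (h.contDiffAt.comp (z₀ : ℂ) hφ).contMDiffAt.comp z₀ hc.contMDiffAt
    convert hcomp using 1
    funext z
    congr 1
    have : Circle.exp (φ z) = Circle.exp θ * Circle.exp (Complex.arg ((z / z₀ : Circle) : ℂ)) := by
      rw [← Circle.exp_add]; simp [φ, Complex.log_im]
    rw [this, Circle.exp_arg, hθ]
    simp

namespace Smooth

theorem contDiff_exp (f : Smooth) : ContDiff ℝ ∞ (fun t : ℝ => f (Circle.exp t)) :=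
  (contMDiff_iff_contDiff_exp _).1 f.2

theorem continuous (f : Smooth) : Continuous (f : Circle → ℂ) := f.contMDiff.continuous

end Smooth

/-- The derivative of a function on the circle with respect to the variable `z ∈ 𝕋`:
as `z` moves along `t ↦ z * exp (i t)`, this is `(df/dt) / (dz/dt)` with `dz/dt = i z` at `t = 0`.
In particular the derivative of `z ^ n` is `n * z ^ (n - 1)`. -/
noncomputable def circleDeriv (f : Circle → ℂ) (z : Circle) : ℂ :=
  deriv (fun t : ℝ => f (z * Circle.exp t)) 0 / (Complex.I * z)

theorem circleDeriv_exp (f : Circle → ℂ) (s : ℝ) :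
    circleDeriv f (Circle.exp s) =
      deriv (fun t : ℝ => f (Circle.exp t)) s / (Complex.I * Circle.exp s) := by
  unfold circleDeriv
  congr 1
  have := deriv_comp_const_add (f := fun t : ℝ => f (Circle.exp t)) s 0
  simpa [Circle.exp_add] using this

theorem Smooth.differentiableAt (f : Smooth) (z : Circle) :
    DifferentiableAt ℝ (fun t : ℝ => f (z * Circle.exp t)) 0 := by
  obtain ⟨θ, rfl⟩ : ∃ θ : ℝ, Circle.exp θ = z := ⟨_, Circle.exp_arg z⟩
  have h : Differentiable ℝ (fun t : ℝ => f (Circle.exp t)) := f.contDiff_exp.differentiable (by simp)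
  have := (h.comp (differentiable_id.const_add θ)).differentiableAt (x := (0 : ℝ))
  simpa [Function.comp_def, Circle.exp_add] using this

/-- The derivative `f ↦ f'` as a linear map of `C^∞(𝕋)`. -/
noncomputable def D : Smooth →ₗ[ℂ] Smooth where
  toFun f := ⟨circleDeriv f, by
    refine (contMDiff_iff_contDiff_exp _).2 ?_
    simp only [circleDeriv_exp]
    have h1 : ContDiff ℝ ∞ (deriv (fun t : ℝ => f (Circle.exp t))) :=
      (contDiff_infty_iff_deriv.1 f.contDiff_exp).2
    have h2 : ContDiff ℝ ∞ (fun t : ℝ => Complex.I * (Circle.exp t : ℂ)) := by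
      simp only [Circle.coe_exp]
      have h0 : ContDiff ℝ ∞ (fun t : ℝ => (t : ℂ)) := Complex.ofRealCLM.contDiff
      fun_prop
    simp only [div_eq_mul_inv]
    exact h1.mul (h2.inv fun t => mul_ne_zero Complex.I_ne_zero (Circle.coe_ne_zero _))⟩
  map_add' f g := by
    refine Smooth.ext fun z => ?_
    change circleDeriv (f + g) z = circleDeriv f z + circleDeriv g z
    unfold circleDeriv
    rw [← add_div, ← deriv_fun_add (f.differentiableAt z) (g.differentiableAt z)]
    rfl
  map_smul' c f := by
    refine Smooth.ext fun z => ?_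
    change circleDeriv (c • f) z = c * circleDeriv f z
    unfold circleDeriv
    rw [← mul_div_assoc, ← deriv_const_mul c (f.differentiableAt z)]
    rfl

theorem D_apply (f : Smooth) (z : Circle) : D f z = circleDeriv f z := rfl

/-- The Fourier coefficient `f̂(n) = (1/2π) ∫ f(e^{it}) e^{-int} dt`. -/
noncomputable def coeff (f : Circle → ℂ) (n : ℤ) : ℂ :=
  haveI : Fact (0 < 2 * π) := ⟨Real.two_pi_pos⟩
  fourierCoeff (fun x : AddCircle (2 * π) => f x.toCircle) n

theorem coeff_eq_integral (f : Circle → ℂ) (n : ℤ) :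
    coeff f n = (1 / (2 * π) : ℝ) •
      ∫ t in (0 : ℝ)..(2 * π), Complex.exp (-(n * t * Complex.I)) * f (Circle.exp t) := by
  have : Fact (0 < 2 * π) := ⟨Real.two_pi_pos⟩
  have hpi : (π : ℂ) ≠ 0 := by exact_mod_cast Real.pi_ne_zero
  unfold coeff
  rw [fourierCoeff_eq_intervalIntegral _ n 0, zero_add]
  congr 1
  refine intervalIntegral.integral_congr fun t _ => ?_
  simp only [fourier_coe_apply, AddCircle.toCircle_apply_mk, smul_eq_mul]
  rw [div_self (by positivity), one_mul]
  congr 2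
  push_cast
  field_simp

theorem intervalIntegrable_coeff (f : Smooth) (n : ℤ) (a b : ℝ) :
    IntervalIntegrable (fun t : ℝ => Complex.exp (-(n * t * Complex.I)) * f (Circle.exp t))
      volume a b := by
  apply Continuous.intervalIntegrable
  have h1 := f.contDiff_exp.continuous
  have h2 : Continuous (fun t : ℝ => Complex.exp (-(n * t * Complex.I))) := by fun_prop
  exact h2.mul h1

theorem coeff_add (f g : Smooth) (n : ℤ) : coeff (f + g : Smooth) n = coeff f n + coeff g n := by
  simp only [coeff_eq_integral, Smooth.add_apply, mul_add]
  rw [intervalIntegral.integral_add (intervalIntegrable_coeff f n _ _)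
    (intervalIntegrable_coeff g n _ _), smul_add]

theorem coeff_smul (c : ℂ) (f : Smooth) (n : ℤ) : coeff (c • f : Smooth) n = c * coeff f n := by
  simp only [coeff_eq_integral, Smooth.smul_apply, mul_left_comm _ c,
    intervalIntegral.integral_const_mul, mul_smul_comm]

/-- The relation `(f')^(n) = (n + 1) f̂(n + 1)`. -/
theorem coeff_D (f : Smooth) (n : ℤ) : coeff (D f) n = (n + 1) * coeff f (n + 1) := by
  have hf := f.contDiff_exp
  have hd : ∀ t : ℝ, HasDerivAt
      (fun t : ℝ => Complex.exp (-(((n + 1 : ℤ) : ℂ) * t * Complex.I)) * f (Circle.exp t))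
      (Complex.I * (Complex.exp (-(n * t * Complex.I)) * D f (Circle.exp t)) -
        Complex.I * (n + 1) *
          (Complex.exp (-(((n + 1 : ℤ) : ℂ) * t * Complex.I)) * f (Circle.exp t))) t := by
    intro t
    have h1 : HasDerivAt (fun t : ℝ => Complex.exp (-(((n + 1 : ℤ) : ℂ) * t * Complex.I)))
        (Complex.exp (-(((n + 1 : ℤ) : ℂ) * t * Complex.I)) *
          (-(((n + 1 : ℤ) : ℂ) * 1 * Complex.I))) t :=
      ((((Complex.ofRealCLM.hasDerivAt (x := t)).const_mul _).mul_const Complex.I).neg).cexp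
    have h2 := ((hf.differentiable (by simp)) t).hasDerivAt
    refine (h1.mul h2).congr_deriv ?_
    rw [D_apply, circleDeriv_exp, Circle.coe_exp]
    have he : Complex.exp (-(((n + 1 : ℤ) : ℂ) * t * Complex.I)) =
        Complex.exp (-(n * t * Complex.I)) / Complex.exp (t * Complex.I) := by
      rw [← Complex.exp_sub]; congr 1; push_cast; ring
    rw [he]
    have := Complex.exp_ne_zero (t * Complex.I)
    have := Complex.I_ne_zero
    push_cast
    field_simp
    ring
  have hint := intervalIntegral.integral_eq_sub_of_hasDerivAt (a := 0) (b := 2 * π)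
    (fun t _ => hd t) (((intervalIntegrable_coeff (D f) n _ _).const_mul _).sub
      ((intervalIntegrable_coeff f (n + 1) _ _).const_mul _))
  rw [intervalIntegral.integral_sub ((intervalIntegrable_coeff (D f) n _ _).const_mul _)
      ((intervalIntegrable_coeff f (n + 1) _ _).const_mul _),
    intervalIntegral.integral_const_mul, intervalIntegral.integral_const_mul] at hint
  have hper : Complex.exp (-(((n + 1 : ℤ) : ℂ) * ((2 * π : ℝ) : ℂ) * Complex.I)) = 1 := by
    rw [Complex.exp_eq_one_iff]
    exact ⟨-(n + 1), by push_cast; ring⟩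
  rw [hper] at hint
  simp only [Circle.exp_two_pi, Circle.exp_zero, Complex.ofReal_zero, mul_zero, zero_mul, neg_zero,
    Complex.exp_zero, sub_self] at hint
  rw [mul_assoc, ← mul_sub, mul_eq_zero] at hint
  have h := sub_eq_zero.1 (hint.resolve_left Complex.I_ne_zero)
  rw [coeff_eq_integral, coeff_eq_integral, h, mul_smul_comm]

theorem exists_coeff_bound (k : ℕ) (f : Smooth) :
    ∃ C : ℝ, ∀ n : ℤ, ‖coeff f n‖ * (1 + |(n : ℝ)|) ^ k ≤ C := by
  induction k generalizing f with
  | zero =>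
    obtain ⟨M, hM⟩ := isCompact_univ.exists_bound_of_continuousOn f.continuous.continuousOn
    refine ⟨M, fun n => ?_⟩
    rw [pow_zero, mul_one, coeff_eq_integral, norm_smul]
    have h := intervalIntegral.norm_integral_le_of_norm_le_const (a := 0) (b := 2 * π) (C := M)
      (f := fun t : ℝ => Complex.exp (-(n * t * Complex.I)) * f (Circle.exp t)) (fun t _ => by
        rw [norm_mul]
        have : ‖Complex.exp (-(n * t * Complex.I))‖ = 1 := by
          rw [Complex.norm_exp]; simp
        rw [this, one_mul]
        exact hM _ (mem_univ _))
    have hpi := Real.two_pi_pos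
    rw [sub_zero, abs_of_pos hpi] at h
    rw [Real.norm_of_nonneg (by positivity)]
    calc _ ≤ 1 / (2 * π) * (M * (2 * π)) := by gcongr
      _ = M := by field_simp
  | succ k ih =>
    obtain ⟨A, hA⟩ := ih f
    obtain ⟨B, hB⟩ := ih (D f)
    refine ⟨A + 2 ^ k * B, fun n => ?_⟩
    have h1 := hB (n - 1)
    rw [coeff_D] at h1
    rw [sub_add_cancel] at h1
    have h2 : ((n - 1 : ℤ) : ℂ) + 1 = n := by push_cast; ring
    rw [h2, norm_mul, Complex.norm_intCast] at h1
    have h3 : 1 + |(n : ℝ)| ≤ 2 * (1 + |((n - 1 : ℤ) : ℝ)|) := by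
      have := abs_add_le ((n : ℝ) - 1) 1
      have h0 := abs_nonneg ((n : ℝ) - 1)
      simp only [sub_add_cancel, abs_one] at this
      push_cast
      linarith
    have h4 : (1 + |(n : ℝ)|) ^ k ≤ 2 ^ k * (1 + |((n - 1 : ℤ) : ℝ)|) ^ k := by
      rw [← mul_pow]; gcongr
    calc ‖coeff f n‖ * (1 + |(n : ℝ)|) ^ (k + 1)
        = ‖coeff f n‖ * (1 + |(n : ℝ)|) ^ k +
            |(n : ℝ)| * ‖coeff f n‖ * (1 + |(n : ℝ)|) ^ k := by ring
      _ ≤ A + |(n : ℝ)| * ‖coeff f n‖ * (2 ^ k * (1 + |((n - 1 : ℤ) : ℝ)|) ^ k) := by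
          gcongr
          exact hA n
      _ = A + 2 ^ k * (|(n : ℝ)| * ‖coeff f n‖ * (1 + |((n - 1 : ℤ) : ℝ)|) ^ k) := by ring
      _ ≤ A + 2 ^ k * B := by gcongr

theorem summable_rho (ν : ℝ≥0) (f : Smooth) :
    Summable (fun n : ℤ => ‖coeff f n‖ * (1 + |(n : ℝ)|) ^ (ν : ℝ)) := by
  obtain ⟨k, hk⟩ := exists_nat_ge (ν : ℝ)
  obtain ⟨C, hC⟩ := exists_coeff_bound (k + 2) f
  have hs : Summable (fun n : ℤ => C * (1 / |(n : ℝ)| ^ (2 : ℝ))) :=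
    (Real.summable_abs_int_rpow (b := 2) (by norm_num)).mul_left C |>.congr fun n => by
      rw [Real.rpow_neg (abs_nonneg _), one_div]
  refine Summable.of_norm_bounded_eventually hs ?_
  filter_upwards [(Set.finite_singleton (0 : ℤ)).compl_mem_cofinite] with n hn
  have hn0 : (0 : ℝ) < |(n : ℝ)| := abs_pos.2 (by exact_mod_cast hn)
  have hb : (1 : ℝ) ≤ 1 + |(n : ℝ)| := by linarith
  rw [Real.norm_of_nonneg (by positivity), mul_one_div, le_div_iff₀ (by positivity)]
  refine le_trans ?_ (hC n)
  rw [mul_assoc, pow_add]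
  gcongr
  · rw [← Real.rpow_natCast]
    exact Real.rpow_le_rpow_of_exponent_le hb hk
  · rw [Real.rpow_two]
    gcongr
    linarith

/-- The norms `ρ_ν(f) = ∑ |f̂(n)| (1 + |n|)^ν`, for `ν ≥ 0` real. -/
noncomputable def rho : SeminormFamily ℂ Smooth ℝ≥0 := fun ν =>
  Seminorm.of (fun f => ∑' n : ℤ, ‖coeff f n‖ * (1 + |(n : ℝ)|) ^ (ν : ℝ))
    (fun f g => by
      rw [← (summable_rho ν f).tsum_add (summable_rho ν g)]
      refine (summable_rho ν (f + g)).tsum_le_tsum (fun n => ?_)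
        ((summable_rho ν f).add (summable_rho ν g))
      rw [coeff_add, ← add_mul]
      gcongr
      exact norm_add_le _ _)
    (fun c f => by
      rw [← tsum_mul_left]
      refine tsum_congr fun n => ?_
      rw [coeff_smul, norm_mul, mul_assoc])

/-- The Fréchet topology of `C^∞(𝕋)`, defined by the norms `ρ_ν`. -/
noncomputable instance : TopologicalSpace Smooth := rho.moduleFilterBasis.topology

theorem withSeminorms_rho : WithSeminorms rho := ⟨rfl⟩

/-- Distributions on the circle: the topological dual of `C^∞(𝕋)`. -/
abbrev Distribution : Type := Smooth →L[ℂ] ℂ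

/-- The function `α ^ n`, where `α : z ↦ z`. -/
noncomputable def alphaPow (n : ℤ) : Smooth :=
  ⟨fun z => (z : ℂ) ^ n, (contMDiff_iff_contDiff_exp _).2 (by
    have h : (fun t : ℝ => ((Circle.exp t : Circle) : ℂ) ^ n) =
        fun t : ℝ => Complex.exp (n * (t * Complex.I)) := by
      funext t; rw [Circle.coe_exp, ← Complex.exp_int_mul]
    rw [h]
    have h0 : ContDiff ℝ ∞ (fun t : ℝ => (t : ℂ)) := Complex.ofRealCLM.contDiff
    fun_prop)⟩

/-- The Fourier coefficient `T̂(n) = ⟨α ^ (-n), T⟩` of a distribution. -/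
noncomputable def distCoeff (T : Distribution) (n : ℤ) : ℂ := T (alphaPow (-n))

/-- The space `a^∞`: the smooth functions on the circle that extend to a continuous function on the
closed unit disc, holomorphic in the open disc. -/
def aInf : Submodule ℂ Smooth where
  carrier := {f | ∃ F : ℂ → ℂ, DiffContOnCl ℂ F (Metric.ball 0 1) ∧ ∀ z : Circle, F z = f z}
  add_mem' := by
    rintro f g ⟨F, hF, hf⟩ ⟨G, hG, hg⟩
    exact ⟨F + G, hF.add hG, fun z => by rw [Pi.add_apply, hf, hg, Smooth.add_apply]⟩
  zero_mem' := ⟨fun _ => 0, diffContOnCl_const, fun _ => rfl⟩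
  smul_mem' := by
    rintro c f ⟨F, hF, hf⟩
    exact ⟨c • F, hF.const_smul c, fun z => by
      rw [Pi.smul_apply, hf, Smooth.smul_apply, smul_eq_mul]⟩

/-- `I_∞(E)`: the smooth functions all of whose derivatives (of order `≥ 0`) vanish on `E`. -/
def idealInf (E : Set Circle) : Submodule ℂ Smooth where
  carrier := {f | ∀ i : ℕ, ∀ z ∈ E, (D ^ i) f z = 0}
  add_mem' := fun hf hg i z hz => by
    rw [map_add, Smooth.add_apply, hf i z hz, hg i z hz, add_zero]
  zero_mem' := fun i z _ => by rw [map_zero, Smooth.zero_apply]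
  smul_mem' := fun c f hf i z hz => by
    rw [map_smul, Smooth.smul_apply, hf i z hz, mul_zero]

/-- `I_∞^+(E) = I_∞(E) ∩ a^∞`. -/
noncomputable def idealInfPlus (E : Set Circle) : Submodule ℂ Smooth := idealInf E ⊓ aInf

/-- `V^⊥`: the distributions that vanish on `V`. -/
def annihilator (V : Submodule ℂ Smooth) : Submodule ℂ Distribution where
  carrier := {T | ∀ f ∈ V, T f = 0}
  add_mem' := fun hS hT f hf => by
    rw [_root_.add_apply, hS f hf, hT f hf, add_zero]
  zero_mem' := fun _ _ => rfl
  smul_mem' := fun c T hT f hf => by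
    rw [_root_.smul_apply, hT f hf, smul_zero]

/-- `E` is an interpolation set for `a^∞`: for every `f ∈ C^∞(𝕋)` there is `g ∈ a^∞` whose
derivatives of all orders `≥ 0` agree on `E` with those of `f`. -/
def IsInterpolationSet (E : Set Circle) : Prop :=
  ∀ f : Smooth, ∃ g ∈ aInf, ∀ i : ℕ, ∀ z ∈ E, (D ^ i) f z = (D ^ i) g z

/-- `I_∞^+(E)^⊥ = I_∞(E)^⊥ + (a^∞)^⊥`. -/
def AnnihilatorSplits (E : Set Circle) : Prop :=
  annihilator (idealInfPlus E) = annihilator (idealInf E) ⊔ annihilator aInf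

/-- For every `s ≥ 0` there are `C > 0` and `t ≥ 0` with
`sup_{n ∈ ℤ} |T̂(n)| / (1 + |n|)^t ≤ C sup_{n ≤ 0} |T̂(n)| / (1 + |n|)^s` for all `T ∈ I_∞(E)^⊥`.
The suprema are taken in `[0, ∞]`; the right-hand side may be infinite. -/
def CoeffEstimate (E : Set Circle) : Prop :=
  ∀ s : ℝ, 0 ≤ s → ∃ C : ℝ, 0 < C ∧ ∃ t : ℝ, 0 ≤ t ∧ ∀ T ∈ annihilator (idealInf E),
    (⨆ n : ℤ, ENNReal.ofReal (‖distCoeff T n‖ / (1 + |(n : ℝ)|) ^ t)) ≤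
      ENNReal.ofReal C *
        ⨆ (n : ℤ) (_ : n ≤ 0), ENNReal.ofReal (‖distCoeff T n‖ / (1 + |(n : ℝ)|) ^ s)

end CircleInterp

open Filter Topology
open scoped Pointwise

/-!
Condition (i) says that `a^∞ + I_∞(E) = C^∞(𝕋)`, that is, that the addition map
`a^∞ × I_∞(E) → C^∞(𝕋)` between Fréchet spaces is surjective. By the open mapping theorem this holds
exactly when the transpose of that map is bounded below on equicontinuous sets, and (iii) is this
lower bound, restricted to `I_∞(E)^⊥` and written in terms of Fourier coefficients. An open
surjection is a quotient map, so that every functional on the product vanishing on its kernel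
factors through it, which gives (ii). Conversely, (ii) says that each such functional factors
through the addition map, and by uniform boundedness this gives the lower bound as soon as the range
is dense. For `E` not dense in `𝕋` the range is dense, by Hahn–Banach: a distribution vanishing on
both subspaces, convolved with a bump function, becomes a function in `a^∞` that is zero on an arc,
hence zero.
-/

namespace CircleInterp

/-! ### Nearly open maps -/

section OpenMapping

variable {G H : Type*} [AddCommGroup G] [AddCommGroup H]

/-- A map between topological groups is nearly open at the origin if the closure of the image of
every neighbourhood of `0` is a neighbourhood of `0`. -/
def NearlyOpen [TopologicalSpace G] [TopologicalSpace H] (f : G → H) : Prop :=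
  ∀ U ∈ 𝓝 (0 : G), closure (f '' U) ∈ 𝓝 (0 : H)

theorem sub_mem_of_forall_succ_sub_mem {u : ℕ → Set G} (hzero : ∀ n, 0 ∈ u n)
    (hadd : ∀ n, u (n + 1) + u (n + 1) ⊆ u n) {x : ℕ → G}
    (hx : ∀ n, x (n + 1) - x n ∈ u (n + 1)) {m n : ℕ} (hmn : m ≤ n) : x n - x m ∈ u m :=
  Nat.decreasingInduction'
    (fun k _ _ hk => hadd k ⟨_, hk, _, hx k, sub_add_sub_cancel _ _ _⟩) hmn
    (by simpa only [sub_self] using hzero n)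

theorem cauchySeq_of_forall_succ_sub_mem [UniformSpace G] [IsUniformAddGroup G] {u : ℕ → Set G}
    (hu : (𝓝 (0 : G)).HasAntitoneBasis u) (hadd : ∀ n, u (n + 1) + u (n + 1) ⊆ u n) {x : ℕ → G}
    (hx : ∀ n, x (n + 1) - x n ∈ u (n + 1)) : CauchySeq x := by
  have hbasis : (uniformity G).HasBasis (fun _ => True) fun n => {p | p.2 - p.1 ∈ u n} := by
    rw [uniformity_eq_comap_nhds_zero]
    exact hu.toHasBasis.comap _
  have hneg : (uniformity G).HasBasis (fun _ => True) fun n => {p | p.1 - p.2 ∈ u n} := by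
    rw [← comap_swap_uniformity]
    exact hbasis.comap Prod.swap
  exact hneg.cauchySeq_iff'.2 fun m _ => ⟨m, fun n hmn =>
    sub_mem_of_forall_succ_sub_mem (fun k => mem_of_mem_nhds (hu.mem k)) hadd hx hmn⟩

theorem tendsto_zero_of_forall_mem_closure_image [TopologicalSpace G] [TopologicalSpace H]
    [RegularSpace H] {u : ℕ → Set G} (hu : (𝓝 (0 : G)).HasAntitoneBasis u) {f : G →+ H}
    (hf : Continuous f) {y : ℕ → H} (hy : ∀ n, y n ∈ closure (f '' u (n + 1))) :
    Tendsto y atTop (𝓝 0) := by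
  refine (closed_nhds_basis (0 : H)).tendsto_right_iff.2 fun N ⟨hN, hNc⟩ => ?_
  have hpre : f ⁻¹' N ∈ 𝓝 0 := hf.continuousAt.preimage_mem_nhds (by rwa [map_zero])
  obtain ⟨m, hm⟩ := hu.mem_iff.1 hpre
  filter_upwards [eventually_ge_atTop m] with n hn
  have hsub : f '' u (n + 1) ⊆ N := image_subset_iff.2 ((hu.antitone (by omega)).trans hm)
  exact closure_minimal hsub hNc (hy n)

/-- One step of the successive approximation: the error `y`, almost in `f '' V`, is corrected to
an error almost in `f '' W`. -/
theorem NearlyOpen.exists_sub_mem_closure [TopologicalSpace G] [TopologicalSpace H]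
    [IsTopologicalAddGroup H] {f : G → H} (hf : NearlyOpen f) {V W : Set G} (hW : W ∈ 𝓝 (0 : G))
    {y : H} (hy : y ∈ closure (f '' V)) : ∃ x ∈ V, y - f x ∈ closure (f '' W) := by
  have hnhds : {z | y - z ∈ closure (f '' W)} ∈ 𝓝 y :=
    (continuous_sub_left y).continuousAt.preimage_mem_nhds (by simpa only [sub_self] using hf W hW)
  obtain ⟨_, hz, x, hx, rfl⟩ := mem_closure_iff_nhds.1 hy _ hnhds
  exact ⟨x, hx, hz⟩

theorem NearlyOpen.closure_image_subset [UniformSpace G] [IsUniformAddGroup G] [CompleteSpace G]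
    [TopologicalSpace H] [IsTopologicalAddGroup H] [T2Space H] {f : G →+ H} (hf : Continuous f)
    (hno : NearlyOpen f) {u : ℕ → Set G} (hu : (𝓝 (0 : G)).HasAntitoneBasis u)
    (hadd : ∀ n, u (n + 1) + u (n + 1) ⊆ u n) :
    closure (f '' u 1) ⊆ f '' closure (u 0) := by
  intro y hy
  choose! c hc hcy using fun (n : ℕ) (z : H) (hz : z ∈ closure (f '' u (n + 1))) =>
    hno.exists_sub_mem_closure (hu.mem (n + 2)) hz
  let x : ℕ → G := fun n => Nat.rec 0 (fun k xk => xk + c k (y - f xk)) n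
  have herr : ∀ n, y - f (x n) ∈ closure (f '' u (n + 1)) := fun n => by
    induction n with
    | zero => simpa [x] using hy
    | succ n ih =>
      have h : y - f (x (n + 1)) = y - f (x n) - f (c n (y - f (x n))) := by
        simp only [x, map_add, sub_add_eq_sub_sub]
      exact h ▸ hcy n _ ih
  have hstep : ∀ n, x (n + 1) - x n ∈ u (n + 1) := fun n => by
    have h : x (n + 1) - x n = c n (y - f (x n)) := add_sub_cancel_left _ _
    exact h ▸ hc n _ (herr n)
  have hmem : ∀ n, x n ∈ u 0 := fun n => by
    have h := sub_mem_of_forall_succ_sub_mem (fun k => mem_of_mem_nhds (hu.mem k)) hadd hstep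
      (Nat.zero_le n)
    rwa [show x 0 = 0 from rfl, sub_zero] at h
  obtain ⟨a, ha⟩ := cauchySeq_tendsto_of_complete (cauchySeq_of_forall_succ_sub_mem hu hadd hstep)
  have hlim : Tendsto (fun n => y - f (x n)) atTop (𝓝 (y - f a)) :=
    ((hf.tendsto a).comp ha).const_sub y
  have hfa : y - f a = 0 :=
    tendsto_nhds_unique hlim (tendsto_zero_of_forall_mem_closure_image hu hf herr)
  exact ⟨a, mem_closure_of_tendsto ha (.of_forall hmem), (sub_eq_zero.1 hfa).symm⟩

theorem NearlyOpen.isOpenMap [UniformSpace G] [IsUniformAddGroup G] [CompleteSpace G]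
    [FirstCountableTopology G] [TopologicalSpace H] [IsTopologicalAddGroup H] [T2Space H]
    {f : G →+ H} (hf : Continuous f) (hno : NearlyOpen f) : IsOpenMap f := by
  refine IsTopologicalAddGroup.isOpenMap_iff_nhds_zero.2 fun s hs => ?_
  obtain ⟨u, hu, hadd⟩ := IsTopologicalAddGroup.exists_antitone_basis_nhds_zero G
  obtain ⟨N, ⟨hN, hNc⟩, hNs⟩ := (closed_nhds_basis (0 : G)).mem_iff.1 hs
  obtain ⟨m, hm⟩ := hu.mem_iff.1 hN
  have hu' : (𝓝 (0 : G)).HasAntitoneBasis fun n => u (n + m) :=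
    hu.comp_mono (fun _ _ h => by omega) (tendsto_add_atTop_nat m)
  have hsub := hno.closure_image_subset hf hu' fun n => by
    simpa only [Nat.add_right_comm] using hadd (n + m)
  rw [zero_add] at hsub
  exact mem_of_superset (hno _ (hu'.mem 1))
    (hsub.trans (image_subset_iff.2 ((closure_minimal hm hNc).trans hNs)))

end OpenMapping

/-! ### Seminorms and continuous functionals -/

section Seminorms

variable {𝕜 E : Type*} [RCLike 𝕜] [AddCommGroup E] [Module 𝕜 E]

theorem seminorm_le_mul_of_forall_lt_one {p q : Seminorm 𝕜 E} {M : ℝ}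
    (h : ∀ x, p x < 1 → q x ≤ M) (x : E) : q x ≤ M * p x := by
  have hcont : Tendsto (M * ·) (𝓝[>] p x) (𝓝 (M * p x)) :=
    (continuous_const_mul M).continuousWithinAt
  refine ge_of_tendsto hcont ?_
  filter_upwards [self_mem_nhdsWithin] with r (hr : p x < r)
  have hr0 : 0 < r := (apply_nonneg p x).trans_lt hr
  have hnorm : ‖((r : 𝕜))⁻¹‖ = r⁻¹ := by rw [norm_inv, RCLike.norm_of_nonneg hr0.le]
  have hscaled := h ((r : 𝕜)⁻¹ • x) <| by
    rwa [map_smul_eq_mul, hnorm, inv_mul_lt_one₀ hr0]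
  rwa [map_smul_eq_mul, hnorm, inv_mul_le_iff₀ hr0, mul_comm] at hscaled

/-- Uniform boundedness principle for a seminorm. -/
theorem exists_forall_seminorm_le {ι : Type*} (p : Seminorm 𝕜 E) {y : ι → E}
    (hy : ∀ (T : E →ₗ[𝕜] 𝕜) (C : ℝ), (∀ x, ‖T x‖ ≤ C * p x) → ∃ M, ∀ i, ‖T (y i)‖ ≤ M) :
    ∃ M, ∀ i, p (y i) ≤ M := by
  let : SeminormedAddCommGroup E := p.toSeminormedAddCommGroup
  let : NormedSpace 𝕜 E := { norm_smul_le := fun c x => (map_smul_eq_mul p c x).le }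
  have hpointwise (T : StrongDual 𝕜 E) :
      ∃ M, ∀ i, ‖NormedSpace.inclusionInDoubleDual 𝕜 E (y i) T‖ ≤ M :=
    hy T ‖T‖ T.le_opNorm
  obtain ⟨M, hM⟩ := banach_steinhaus hpointwise
  refine ⟨M, fun i => ?_⟩
  obtain ⟨T, hT, hTy⟩ := exists_dual_vector'' 𝕜 (y i)
  calc p (y i) = ‖T (y i)‖ := by rw [hTy, RCLike.norm_ofReal, abs_norm]; rfl
    _ ≤ ‖NormedSpace.inclusionInDoubleDual 𝕜 E (y i)‖ :=
      (NormedSpace.inclusionInDoubleDual 𝕜 E (y i)).unit_le_opNorm T hT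
    _ ≤ M := hM i

theorem exists_continuous_seminorm_ball_subset [TopologicalSpace E] [PolynormableSpace 𝕜 E]
    {U : Set E} (hU : U ∈ 𝓝 (0 : E)) :
    ∃ p : Seminorm 𝕜 E, Continuous p ∧ p.ball 0 1 ⊆ U := by
  have hE := PolynormableSpace.withSeminorms 𝕜 E
  have := hE.topologicalAddGroup
  obtain ⟨⟨t, r⟩, hr, hball⟩ := hE.hasBasis_zero_ball.mem_iff.1 hU
  lift r to ℝ≥0 using hr.le
  refine ⟨r⁻¹ • t.sup fun p => p.1, (Seminorm.continuous_finsetSup fun p _ => p.2).const_smul _, ?_⟩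
  rwa [Seminorm.ball_smul _ (inv_pos.2 hr), NNReal.coe_inv, div_inv_eq_mul, one_mul]

theorem exists_dual_norm_le_one_of_notMem [TopologicalSpace E] [PolynormableSpace 𝕜 E]
    [Module ℝ E] [IsScalarTower ℝ 𝕜 E] {s : Set E} (hzero : 0 ∈ s) (hconv : Convex ℝ s)
    (hbal : Balanced 𝕜 s) (hs : IsClosed s) {y : E} (hy : y ∉ s) :
    ∃ T : StrongDual 𝕜 E, (∀ x ∈ s, ‖T x‖ ≤ 1) ∧ 1 < ‖T y‖ := by
  have hE := PolynormableSpace.withSeminorms 𝕜 E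
  have := hE.topologicalAddGroup
  have := hE.continuousSMul
  have := hE.toLocallyConvexSpace
  obtain ⟨T, u, hTu, huy⟩ := RCLike.geometric_hahn_banach_closed_point (𝕜 := 𝕜) hconv hs hy
  have hu : 0 < u := by simpa only [map_zero] using hTu 0 hzero
  have hnorm (x : E) : ‖((u : 𝕜)⁻¹ • T) x‖ = u⁻¹ * ‖T x‖ := by
    rw [_root_.smul_apply, norm_smul, norm_inv, RCLike.norm_of_nonneg hu.le]
  refine ⟨(u : 𝕜)⁻¹ • T, fun x hx => ?_, ?_⟩
  · obtain ⟨c, hc, hcx⟩ := RCLike.exists_norm_eq_mul_self (T x)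
    have hTcx := hTu (c • x) (hbal.smul_mem hc.le hx)
    rw [map_smul, smul_eq_mul, ← hcx, RCLike.ofReal_re] at hTcx
    rw [hnorm, inv_mul_le_one₀ hu]
    exact hTcx.le
  · rw [hnorm, one_lt_inv_mul₀ hu]
    exact huy.trans_le (RCLike.re_le_norm _)

theorem dense_of_forall_dual_eq_zero [TopologicalSpace E] [PolynormableSpace 𝕜 E]
    {V : Submodule 𝕜 E} (h : ∀ T : StrongDual 𝕜 E, (∀ x ∈ V, T x = 0) → T = 0) :
    Dense (V : Set E) := by
  have hE := PolynormableSpace.withSeminorms 𝕜 E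
  have := hE.topologicalAddGroup
  have := hE.continuousSMul
  let : Module ℝ E := .restrictScalars ℝ 𝕜 E
  have : IsScalarTower ℝ 𝕜 E := .restrictScalars _ _ _
  let W := V.topologicalClosure
  by_contra hV
  obtain ⟨y, hy⟩ : ∃ y, y ∉ (W : Set E) := by simpa [Dense] using! hV
  obtain ⟨T, hT, hTy⟩ := exists_dual_norm_le_one_of_notMem W.zero_mem
    (W.restrictScalars ℝ).convex
    (fun c _ => image_subset_iff.2 fun x hx => W.smul_mem c hx) V.isClosed_topologicalClosure hy
  have hTV : ∀ x ∈ V, T x = 0 := fun x hx => by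
    by_contra hTx
    have h2 := hT _ (subset_closure (V.smul_mem (2 / T x) hx))
    rw [map_smul, smul_eq_mul, div_mul_cancel₀ _ hTx, RCLike.norm_ofNat] at h2
    norm_num at h2
  rw [h T hTV, _root_.zero_apply, norm_zero] at hTy
  exact (hTy.trans one_pos).false

theorem exists_continuous_seminorm_le_comp {F : Type*} [AddCommGroup F] [Module 𝕜 F]
    [TopologicalSpace F] [FirstCountableTopology F] [PolynormableSpace 𝕜 F] (f : E →ₗ[𝕜] F)
    (p : Seminorm 𝕜 E) (hp : ∀ (T : E →ₗ[𝕜] 𝕜) (C : ℝ), (∀ x, ‖T x‖ ≤ C * p x) →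
      ∃ S : StrongDual 𝕜 F, ∀ x, S (f x) = T x) :
    ∃ q : Seminorm 𝕜 F, Continuous q ∧ ∀ x, p x ≤ q (f x) := by
  obtain ⟨V, hV, M, hVM⟩ : ∃ V ∈ 𝓝 (0 : F), ∃ M, ∀ x, f x ∈ V → p x ≤ M := by
    by_contra! hunbdd
    obtain ⟨u, hu⟩ := (𝓝 (0 : F)).exists_antitone_basis
    choose x hxu hpx using fun n : ℕ => hunbdd (u n) (hu.mem n) n
    obtain ⟨M, hM⟩ := exists_forall_seminorm_le p (y := x) fun T C hT => by
      obtain ⟨S, hS⟩ := hp T C hT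
      have hlim : Tendsto (fun n => T (x n)) atTop (𝓝 0) := by
        simpa only [Function.comp_def, hS, map_zero] using
          (S.continuous.tendsto 0).comp (hu.tendsto hxu)
      exact (Metric.isBounded_range_of_tendsto _ hlim).exists_norm_le.imp
        fun M hM n => hM _ (mem_range_self n)
    obtain ⟨n, hn⟩ := exists_nat_gt M
    exact ((hn.trans (hpx n)).trans_le (hM n)).false
  obtain ⟨q, hq, hqV⟩ := exists_continuous_seminorm_ball_subset (𝕜 := 𝕜) hV
  refine ⟨M.toNNReal • q, hq.const_smul _, fun x => ?_⟩
  have hle : p x ≤ M * q (f x) := seminorm_le_mul_of_forall_lt_one (p := q.comp f)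
    (fun x hx => hVM x (hqV (by simpa using hx))) x
  exact hle.trans (mul_le_mul_of_nonneg_right (Real.le_coe_toNNReal M) (apply_nonneg q _))

end Seminorms

/-! ### Maps whose adjoint is bounded below -/

section Adjoint

variable {𝕜 E F : Type*} [RCLike 𝕜]
  [AddCommGroup E] [Module 𝕜 E] [TopologicalSpace E]
  [AddCommGroup F] [Module 𝕜 F] [TopologicalSpace F]

/-- The adjoint of `f` is bounded below: each continuous seminorm `p` on `E` has a continuous
seminorm `q` on `F` such that a functional on `F` is dominated by `q` as soon as its pullback to `E`
is dominated by `p`. -/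
def AdjointBoundedBelow (f : E →L[𝕜] F) : Prop :=
  ∀ p : Seminorm 𝕜 E, Continuous p → ∃ q : Seminorm 𝕜 F, Continuous q ∧
    ∀ S : StrongDual 𝕜 F, (∀ x, ‖S (f x)‖ ≤ p x) → ∀ y, ‖S y‖ ≤ q y

theorem AdjointBoundedBelow.nearlyOpen [PolynormableSpace 𝕜 E] [PolynormableSpace 𝕜 F]
    {f : E →L[𝕜] F} (hf : AdjointBoundedBelow f) : NearlyOpen f := by
  intro U hU
  obtain ⟨p, hp, hpU⟩ := exists_continuous_seminorm_ball_subset (𝕜 := 𝕜) hU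
  obtain ⟨q, hq, hpq⟩ := hf p hp
  let : Module ℝ E := .restrictScalars ℝ 𝕜 E
  have : IsScalarTower ℝ 𝕜 E := .restrictScalars _ _ _
  let : Module ℝ F := .restrictScalars ℝ 𝕜 F
  have : IsScalarTower ℝ 𝕜 F := .restrictScalars _ _ _
  have hF := PolynormableSpace.withSeminorms 𝕜 F
  have := hF.topologicalAddGroup
  have := hF.continuousSMul
  have := IsScalarTower.continuousSMul (M := ℝ) (α := F) 𝕜
  let s := closure (f '' p.ball 0 1)
  have hzero : 0 ∈ s := subset_closure ⟨0, by simp, map_zero f⟩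
  have hconv : Convex ℝ s :=
    ((p.convex_ball 0 1).is_linear_image (f.restrictScalars ℝ).toLinearMap.isLinear).closure
  have hbal : Balanced 𝕜 s := Balanced.closure fun c hc => by
    rintro _ ⟨_, ⟨x, hx, rfl⟩, rfl⟩
    exact ⟨c • x, (p.balanced_ball_zero 1).smul_mem hc hx, map_smul f c x⟩
  have hqs : q.ball 0 1 ⊆ s := fun y hy => by
    by_contra hys
    obtain ⟨S, hS, hSy⟩ := exists_dual_norm_le_one_of_notMem hzero hconv hbal isClosed_closure hys
    have hSp (x : E) : ‖S (f x)‖ ≤ p x :=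
      (seminorm_le_mul_of_forall_lt_one (q := (S.comp f).toLinearMap.toSeminorm) (M := 1)
        (fun x hx => hS _ (subset_closure ⟨x, by simpa using hx, rfl⟩)) x).trans_eq (one_mul _)
    exact ((hSy.trans_le (hpq S hSp y)).trans (by simpa using hy)).false
  exact mem_of_superset (mem_of_superset (Seminorm.ball_mem_nhds hq one_pos) hqs)
    (closure_mono (image_mono hpU))

theorem AdjointBoundedBelow.of_surjective [BarrelledSpace 𝕜 F] {f : E →L[𝕜] F}
    (hf : Function.Surjective f) : AdjointBoundedBelow f := by
  intro p _
  let q (S : {S : StrongDual 𝕜 F // ∀ x, ‖S (f x)‖ ≤ p x}) : Seminorm 𝕜 F :=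
    S.1.toLinearMap.toSeminorm
  have hbdd : BddAbove (range q) := by
    refine Seminorm.bddAbove_range_iff.2 fun y => ?_
    obtain ⟨x, rfl⟩ := hf y
    exact ⟨p x, forall_mem_range.2 fun S => S.2 x⟩
  refine ⟨⨆ S, q S, ?_, fun S hS => le_ciSup hbdd ⟨S, hS⟩⟩
  rw [Seminorm.coe_iSup_eq hbdd]
  exact Seminorm.continuous_iSup q (fun S => S.1.continuous.norm) hbdd

theorem AdjointBoundedBelow.of_denseRange [PolynormableSpace 𝕜 E] [FirstCountableTopology F]
    [PolynormableSpace 𝕜 F] {f : E →L[𝕜] F} (hdense : DenseRange f)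
    (hf : ∀ T : StrongDual 𝕜 E, (∀ x, f x = 0 → T x = 0) →
      ∃ S : StrongDual 𝕜 F, ∀ x, S (f x) = T x) :
    AdjointBoundedBelow f := by
  intro p hp
  let g (S : {S : StrongDual 𝕜 F // ∀ x, ‖S (f x)‖ ≤ p x}) : Seminorm 𝕜 E :=
    (S.1.comp f).toLinearMap.toSeminorm
  have hbdd : BddAbove (range g) := ⟨p, forall_mem_range.2 fun S => S.2⟩
  have : Nonempty {S : StrongDual 𝕜 F // ∀ x, ‖S (f x)‖ ≤ p x} :=
    ⟨0, fun x => by simp only [_root_.zero_apply, norm_zero, apply_nonneg]⟩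
  have hsup : ⨆ S, g S ≤ p := ciSup_le fun S => S.2
  obtain ⟨q, hq, hgq⟩ := exists_continuous_seminorm_le_comp f.toLinearMap (⨆ S, g S)
    fun T C hT => by
      have hTp : T.toSeminorm ≤ C.toNNReal • p := fun x =>
        (hT x).trans <| mul_le_mul (Real.le_coe_toNNReal C) (hsup x) (apply_nonneg _ x) C.toNNReal.2
      have hcont : Continuous T :=
        (PolynormableSpace.withSeminorms 𝕜 E).continuous_normedSpace_rng 𝕜 T
          ⟨{⟨p, hp⟩}, C.toNNReal, by rwa [Finset.sup_singleton]⟩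
      refine hf ⟨T, hcont⟩ fun x hx => norm_le_zero_iff.1 ((hT x).trans_eq ?_)
      rw [Seminorm.iSup_apply hbdd]
      simp [g, hx]
  refine ⟨q, hq, fun S hS y => ?_⟩
  exact hdense.induction_on y (isClosed_le S.continuous.norm hq)
    fun x => (le_ciSup hbdd ⟨S, hS⟩ x).trans (hgq x)

theorem exists_dual_comp_eq_of_isOpenMap {f : E →L[𝕜] F} (hf : IsOpenMap f)
    (hsurj : Function.Surjective f) (T : StrongDual 𝕜 E) (hT : ∀ x, f x = 0 → T x = 0) :
    ∃ S : StrongDual 𝕜 F, ∀ x, S (f x) = T x := by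
  obtain ⟨g, hg⟩ := f.toLinearMap.exists_rightInverse_of_surjective
    (LinearMap.range_eq_top.2 hsurj)
  have hTg (x : E) : T (g (f x)) = T x := by
    rw [← sub_eq_zero, ← map_sub]
    exact hT _ (by rw [map_sub, sub_eq_zero]; exact LinearMap.congr_fun hg (f x))
  have hcont : Continuous (T.toLinearMap ∘ₗ g) := by
    refine (hf.isQuotientMap f.continuous hsurj).continuous_iff.2 ?_
    convert T.continuous using 1
    exact funext hTg
  exact ⟨⟨T.toLinearMap ∘ₗ g, hcont⟩, hTg⟩

end Adjoint

theorem AdjointBoundedBelow.isOpenMap {𝕜 E F : Type*} [RCLike 𝕜] [AddCommGroup E] [Module 𝕜 E]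
    [UniformSpace E] [IsUniformAddGroup E] [CompleteSpace E] [FirstCountableTopology E]
    [PolynormableSpace 𝕜 E] [AddCommGroup F] [Module 𝕜 F] [TopologicalSpace F] [T2Space F]
    [PolynormableSpace 𝕜 F] {f : E →L[𝕜] F} (hf : AdjointBoundedBelow f) : IsOpenMap f :=
  have := (PolynormableSpace.withSeminorms 𝕜 F).topologicalAddGroup
  hf.nearlyOpen.isOpenMap (f := (f : E →+ F)) f.continuous

theorem surjective_of_isOpenMap {𝕜 E F : Type*} [NontriviallyNormedField 𝕜] [AddCommGroup E]
    [Module 𝕜 E] [TopologicalSpace E] [AddCommGroup F] [Module 𝕜 F] [TopologicalSpace F]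
    [ContinuousAdd F] [ContinuousSMul 𝕜 F] {f : E →ₗ[𝕜] F} (hf : IsOpenMap f) :
    Function.Surjective f := by
  refine LinearMap.range_eq_top.1 (Submodule.eq_top_of_nonempty_interior' f.range ⟨0, ?_⟩)
  exact mem_interior_iff_mem_nhds.2 (map_zero f ▸ hf.range_mem_nhds 0)

/-! ### Sums of closed subspaces of a Fréchet space -/

section Sum

variable {𝕜 X : Type*} [RCLike 𝕜] [AddCommGroup X] [Module 𝕜 X]

/-- The subspace `A` norms the annihilator of `I`: each continuous seminorm `p` has a continuous
seminorm `q` such that a functional vanishing on `I` is dominated by `q` as soon as it is dominated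
by `p` on `A`. -/
def NormsAnnihilator [TopologicalSpace X] (A I : Submodule 𝕜 X) : Prop :=
  ∀ p : Seminorm 𝕜 X, Continuous p → ∃ q : Seminorm 𝕜 X, Continuous q ∧
    ∀ T : StrongDual 𝕜 X, (∀ x ∈ I, T x = 0) → (∀ a ∈ A, ‖T a‖ ≤ p a) → ∀ x, ‖T x‖ ≤ q x

/-- The addition map `(a, x) ↦ a + x`, whose range is `A ⊔ I`. -/
def sumMap [TopologicalSpace X] [ContinuousAdd X] (A I : Submodule 𝕜 X) : A × I →L[𝕜] X :=
  A.subtypeL.coprod I.subtypeL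

theorem sumMap_apply [TopologicalSpace X] [ContinuousAdd X] {A I : Submodule 𝕜 X} (x : A × I) :
    sumMap A I x = x.1 + x.2 := rfl

theorem range_sumMap [TopologicalSpace X] [ContinuousAdd X] (A I : Submodule 𝕜 X) :
    (sumMap A I).range = A ⊔ I := by
  simp [sumMap, LinearMap.range_coprod]

theorem surjective_sumMap_iff [TopologicalSpace X] [ContinuousAdd X] {A I : Submodule 𝕜 X} :
    Function.Surjective (sumMap A I) ↔ A ⊔ I = ⊤ := by
  rw [← range_sumMap]
  exact LinearMap.range_eq_top.symm

theorem AdjointBoundedBelow.normsAnnihilator [TopologicalSpace X] [ContinuousAdd X]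
    {A I : Submodule 𝕜 X} (h : AdjointBoundedBelow (sumMap A I)) : NormsAnnihilator A I := by
  intro p hp
  let P : Seminorm 𝕜 (A × I) := p.comp (A.subtype ∘ₗ LinearMap.fst 𝕜 A I)
  obtain ⟨q, hq, hPq⟩ := h P (hp.comp (continuous_subtype_val.comp continuous_fst))
  refine ⟨q, hq, fun T hTI hTA x => hPq T (fun y => ?_) x⟩
  rw [sumMap_apply, map_add, hTI _ y.2.2, add_zero]
  exact hTA _ y.1.2

theorem NormsAnnihilator.adjointBoundedBelow [TopologicalSpace X] [ContinuousAdd X]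
    [PolynormableSpace 𝕜 X] {A I : Submodule 𝕜 X} (h : NormsAnnihilator A I) :
    AdjointBoundedBelow (sumMap A I) := by
  intro P hP
  obtain ⟨p₁, hp₁, hP₁⟩ := Seminorm.exists_le_comp_of_isInducing (f := A.subtype)
    (p := P.comp (LinearMap.inl 𝕜 A I)) (hP.comp (.prodMk_left 0)) IsInducing.subtypeVal
  obtain ⟨p₂, hp₂, hP₂⟩ := Seminorm.exists_le_comp_of_isInducing (f := I.subtype)
    (p := P.comp (LinearMap.inr 𝕜 A I)) (hP.comp (.prodMk_right 0)) IsInducing.subtypeVal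
  obtain ⟨q, hq, hpq⟩ := h (p₁ + p₂) (hp₁.add hp₂)
  refine ⟨q + p₂, hq.add hp₂, fun S hS x => ?_⟩
  have hSA (a : A) : ‖S a‖ ≤ p₁ a := by
    simpa [sumMap_apply] using (hS (a, 0)).trans (hP₁ a)
  have hSI (y : I) : ‖S y‖ ≤ p₂ y := by
    simpa [sumMap_apply] using (hS (0, y)).trans (hP₂ y)
  obtain ⟨R, hRS, hR⟩ :=
    Module.Dual.exists_continuous_extension_of_le_seminorm I (S.toLinearMap ∘ₗ I.subtype) hp₂ hSI
  have hSR : ‖(S - R) x‖ ≤ q x := by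
    refine hpq (S - R) (fun y hy => sub_eq_zero.2 (hRS ⟨y, hy⟩).symm) (fun a ha => ?_) x
    exact (norm_sub_le _ _).trans (add_le_add (hSA ⟨a, ha⟩) (hR a))
  calc ‖S x‖ = ‖(S - R) x + R x‖ := by rw [_root_.sub_apply, sub_add_cancel]
    _ ≤ q x + p₂ x := (norm_add_le _ _).trans (add_le_add hSR (hR x))

end Sum

section Frechet

variable {𝕜 X : Type*} [RCLike 𝕜] [AddCommGroup X] [Module 𝕜 X] [UniformSpace X]
  [IsUniformAddGroup X] [CompleteSpace X] [(uniformity X).IsCountablyGenerated] [T2Space X]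
  [PolynormableSpace 𝕜 X] {A I : Submodule 𝕜 X}

theorem isOpenMap_sumMap (hA : IsClosed (A : Set X)) (hI : IsClosed (I : Set X))
    (h : AdjointBoundedBelow (sumMap A I)) : IsOpenMap (sumMap A I) := by
  have := hA.completeSpace_coe
  have := hI.completeSpace_coe
  have : IsUniformAddGroup A := A.toAddSubgroup.isUniformAddGroup
  have : IsUniformAddGroup I := I.toAddSubgroup.isUniformAddGroup
  have : FirstCountableTopology A := TopologicalSpace.Subtype.firstCountableTopology _
  have : FirstCountableTopology I := TopologicalSpace.Subtype.firstCountableTopology _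
  exact h.isOpenMap

theorem sup_eq_top_iff_adjointBoundedBelow (hA : IsClosed (A : Set X)) (hI : IsClosed (I : Set X)) :
    A ⊔ I = ⊤ ↔ AdjointBoundedBelow (sumMap A I) := by
  have := (PolynormableSpace.withSeminorms 𝕜 X).continuousSMul
  rw [← surjective_sumMap_iff]
  exact ⟨.of_surjective, fun h => surjective_of_isOpenMap (isOpenMap_sumMap hA hI h)⟩

theorem sup_eq_top_iff_normsAnnihilator (hA : IsClosed (A : Set X)) (hI : IsClosed (I : Set X)) :
    A ⊔ I = ⊤ ↔ NormsAnnihilator A I :=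
  (sup_eq_top_iff_adjointBoundedBelow hA hI).trans ⟨fun h => h.normsAnnihilator,
    fun h => h.adjointBoundedBelow⟩

theorem exists_add_eq_of_sup_eq_top (hA : IsClosed (A : Set X)) (hI : IsClosed (I : Set X))
    (h : A ⊔ I = ⊤) {T : StrongDual 𝕜 X} (hT : ∀ x ∈ A ⊓ I, T x = 0) :
    ∃ R S : StrongDual 𝕜 X, (∀ a ∈ A, R a = 0) ∧ (∀ x ∈ I, S x = 0) ∧ R + S = T := by
  have hopen := isOpenMap_sumMap hA hI ((sup_eq_top_iff_adjointBoundedBelow hA hI).1 h)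
  obtain ⟨S, hS⟩ := exists_dual_comp_eq_of_isOpenMap hopen (surjective_sumMap_iff.2 h)
    (T ∘L A.subtypeL ∘L ContinuousLinearMap.fst 𝕜 A I) fun x hx => by
      rw [sumMap_apply, add_eq_zero_iff_eq_neg] at hx
      have hxI : (x.1 : X) ∈ I := hx ▸ I.neg_mem x.2.2
      exact hT _ ⟨x.1.2, hxI⟩
  have hSA (a : X) (ha : a ∈ A) : S a = T a := by simpa [sumMap_apply] using hS (⟨a, ha⟩, 0)
  have hSI (x : X) (hx : x ∈ I) : S x = 0 := by simpa [sumMap_apply] using hS (0, ⟨x, hx⟩)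
  exact ⟨T - S, S, fun a ha => sub_eq_zero.2 (hSA a ha).symm, hSI, sub_add_cancel T S⟩

theorem sup_eq_top_of_forall_exists_add_eq (hA : IsClosed (A : Set X)) (hI : IsClosed (I : Set X))
    (hdense : Dense ((A ⊔ I : Submodule 𝕜 X) : Set X))
    (hsplit : ∀ T : StrongDual 𝕜 X, (∀ x ∈ A ⊓ I, T x = 0) →
      ∃ R S : StrongDual 𝕜 X, (∀ a ∈ A, R a = 0) ∧ (∀ x ∈ I, S x = 0) ∧ R + S = T) :
    A ⊔ I = ⊤ := by
  rw [← range_sumMap] at hdense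
  refine (sup_eq_top_iff_adjointBoundedBelow hA hI).2 (.of_denseRange hdense fun T hT => ?_)
  obtain ⟨TA, hTA⟩ := StrongDual.exists_extension A (T ∘L ContinuousLinearMap.inl 𝕜 A I)
  obtain ⟨TI, hTI⟩ := StrongDual.exists_extension I (T ∘L ContinuousLinearMap.inr 𝕜 A I)
  have hagree (x : X) (hx : x ∈ A ⊓ I) : (TA - TI) x = 0 := by
    have hker := hT (⟨x, hx.1⟩, -⟨x, hx.2⟩) (by simp [sumMap_apply])
    calc TA x - TI x = T (⟨x, hx.1⟩, 0) - T (0, ⟨x, hx.2⟩) :=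
          congr_arg₂ _ (hTA ⟨x, hx.1⟩) (hTI ⟨x, hx.2⟩)
      _ = 0 := by rw [← map_sub, Prod.mk_sub_mk, sub_zero, zero_sub, hker]
  obtain ⟨R, S, hR, hS, hRS⟩ := hsplit _ hagree
  have hglue : TA - R = TI + S := by
    rw [sub_eq_iff_eq_add, add_assoc, add_comm S R, hRS, add_sub_cancel]
  refine ⟨TA - R, fun x => ?_⟩
  calc (TA - R) (x.1 + x.2) = (TA - R) x.1 + (TI + S) x.2 := by rw [map_add, ← hglue]
    _ = TA x.1 + TI x.2 := by
      rw [_root_.sub_apply, _root_.add_apply, hR _ x.1.2, hS _ x.2.2, sub_zero, add_zero]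
    _ = T (x.1, 0) + T (0, x.2) := congr_arg₂ _ (hTA x.1) (hTI x.2)
    _ = T x := by rw [← map_add, Prod.mk_add_mk, add_zero, zero_add]

end Frechet

/-! ### Fourier series of smooth functions -/

section Fourier

theorem norm_circle_zpow (z : Circle) (n : ℤ) : ‖(z : ℂ) ^ n‖ = 1 := by
  rw [norm_zpow, Circle.norm_coe, one_zpow]

theorem summable_norm_coeff (f : Smooth) : Summable fun n : ℤ => ‖coeff f n‖ := by
  simpa using summable_rho 0 f

theorem hasSum_coeff_mul_zpow (f : Smooth) (z : Circle) :
    HasSum (fun n : ℤ => coeff f n * (z : ℂ) ^ n) (f z) := by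
  have : Fact (0 < 2 * π) := ⟨Real.two_pi_pos⟩
  let F : C(AddCircle (2 * π), ℂ) :=
    ⟨fun x => f x.toCircle, f.continuous.comp AddCircle.continuous_toCircle⟩
  have hF : Summable (fourierCoeff F) := (summable_norm_coeff f).of_norm
  obtain ⟨θ, rfl⟩ : ∃ θ : ℝ, Circle.exp θ = z := ⟨_, Circle.exp_arg z⟩
  have hθ : AddCircle.toCircle (θ : AddCircle (2 * π)) = Circle.exp θ := by
    rw [AddCircle.toCircle_apply_mk, div_self Real.two_pi_pos.ne', one_mul]
  rw [← hθ]
  refine (has_pointwise_sum_fourier_series_of_summable hF θ).congr_fun fun n => ?_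
  simp only [fourier_apply, AddCircle.toCircle_zsmul, smul_eq_mul]
  rfl

theorem Smooth.ext_coeff {f g : Smooth} (h : ∀ n, coeff f n = coeff g n) : f = g :=
  Smooth.ext fun z => (hasSum_coeff_mul_zpow f z).unique <| by
    simpa only [h] using hasSum_coeff_mul_zpow g z

theorem coeff_const_mul (c : ℂ) (f : Circle → ℂ) (n : ℤ) :
    coeff (fun z => c * f z) n = c * coeff f n := by
  simp only [coeff_eq_integral, mul_left_comm _ c, intervalIntegral.integral_const_mul,
    mul_smul_comm]

theorem coeff_zpow (m n : ℤ) : coeff (fun z => (z : ℂ) ^ m) n = if n = m then 1 else 0 := by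
  have : Fact (0 < 2 * π) := ⟨Real.two_pi_pos⟩
  have hm : (fun x : AddCircle (2 * π) => ((x.toCircle : Circle) : ℂ) ^ m) = fourier m := by
    funext x
    simp [fourier_apply, AddCircle.toCircle_zsmul]
  rw [coeff, hm, fourierCoeff_fourier, Pi.single_apply]

theorem coeff_alphaPow (m n : ℤ) : coeff (alphaPow m) n = if n = m then 1 else 0 :=
  coeff_zpow m n

theorem coeff_of_hasSum {c : ℤ → ℂ} (hc : Summable fun n => ‖c n‖) {f : Circle → ℂ}
    (hf : ∀ z : Circle, HasSum (fun n : ℤ => c n * (z : ℂ) ^ n) (f z)) (m : ℤ) :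
    coeff f m = c m := by
  have : Fact (0 < 2 * π) := ⟨Real.two_pi_pos⟩
  let F (n : ℤ) (t : AddCircle (2 * π)) : ℂ := fourier (-m) t • (c n * (t.toCircle : ℂ) ^ n)
  have hFcont (n : ℤ) : Continuous (F n) :=
    (map_continuous (fourier (-m))).smul <| continuous_const.mul <|
      (continuous_subtype_val.comp AddCircle.continuous_toCircle).zpow₀ n fun t =>
        Or.inl (Circle.coe_ne_zero _)
  have hFnorm (n : ℤ) (t : AddCircle (2 * π)) : ‖F n t‖ = ‖c n‖ := by
    simp only [F, norm_smul, norm_mul, norm_circle_zpow, fourier_apply, Circle.norm_coe, one_mul,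
      mul_one]
  have hFsum (t : AddCircle (2 * π)) : ∑' n, F n t = fourier (-m) t • f t.toCircle :=
    ((hf _).const_smul _).tsum_eq
  have hFint (n : ℤ) : ∫ t, F n t ∂AddCircle.haarAddCircle = if n = m then c m else 0 := by
    have h : coeff (fun z => c n * (z : ℂ) ^ n) m = if n = m then c m else 0 := by
      rw [coeff_const_mul, coeff_zpow]
      rcases eq_or_ne n m with rfl | hnm
      · simp
      · simp [hnm, hnm.symm]
    exact h
  have hsum := hasSum_integral_of_summable_integral_norm (μ := AddCircle.haarAddCircle) (F := F)
    (fun n => (hFcont n).integrable_of_hasCompactSupport (HasCompactSupport.of_compactSpace _))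
    (by simpa only [hFnorm, integral_const, probReal_univ, one_smul] using hc)
  simp only [hFsum, hFint] at hsum
  exact hsum.unique (hasSum_ite_eq m (c m))

theorem iteratedDeriv_const_mul_cexp (c a : ℂ) (k : ℕ) :
    iteratedDeriv k (fun t : ℝ => c * Complex.exp (a * t)) =
      fun t : ℝ => c * (a ^ k * Complex.exp (a * t)) := by
  induction k with
  | zero => simp
  | succ k ih =>
    rw [iteratedDeriv_succ, ih]
    funext t
    have h : HasDerivAt (fun t : ℝ => Complex.exp (a * t)) (Complex.exp (a * t) * (a * 1)) t :=
      ((Complex.ofRealCLM.hasDerivAt (x := t)).const_mul a).cexp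
    rw [((h.const_mul _).const_mul _).deriv]
    ring

theorem contDiff_tsum_mul_cexp {c : ℤ → ℂ}
    (hc : ∀ k : ℕ, Summable fun n : ℤ => ‖c n‖ * (1 + |(n : ℝ)|) ^ k) :
    ContDiff ℝ ∞ fun t : ℝ => ∑' n : ℤ, c n * Complex.exp (n * Complex.I * t) := by
  refine contDiff_tsum (fun n => ?_) (fun k _ => hc k) fun k n t _ => ?_
  · have : ContDiff ℝ ∞ (fun t : ℝ => (t : ℂ)) := Complex.ofRealCLM.contDiff
    fun_prop
  · have hexp : ‖Complex.exp (n * Complex.I * t)‖ = 1 := by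
      rw [Complex.norm_exp]
      simp
    rw [norm_iteratedFDeriv_eq_norm_iteratedDeriv, iteratedDeriv_const_mul_cexp, norm_mul,
      norm_mul, hexp, norm_pow, norm_mul, Complex.norm_I, Complex.norm_intCast, mul_one, mul_one]
    gcongr
    linarith

theorem exists_smooth_of_summable {c : ℤ → ℂ}
    (hc : ∀ k : ℕ, Summable fun n : ℤ => ‖c n‖ * (1 + |(n : ℝ)|) ^ k) :
    ∃ f : Smooth, ∀ n, coeff f n = c n := by
  have hnorm : Summable fun n => ‖c n‖ := by simpa using hc 0
  have hsum (z : Circle) : Summable fun n : ℤ => c n * (z : ℂ) ^ n :=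
    Summable.of_norm (by simpa only [norm_mul, norm_circle_zpow, mul_one] using hnorm)
  refine ⟨⟨fun z => ∑' n : ℤ, c n * (z : ℂ) ^ n, (contMDiff_iff_contDiff_exp _).2 ?_⟩, fun n =>
    coeff_of_hasSum hnorm (fun z => (hsum z).hasSum) n⟩
  convert contDiff_tsum_mul_cexp hc using 4 with t n
  rw [Circle.coe_exp, ← Complex.exp_int_mul]
  congr 1
  ring_nf

theorem coeff_eq_zero_of_mem_aInf {f : Smooth} (hf : f ∈ aInf) {n : ℤ} (hn : n < 0) :
    coeff f n = 0 := by
  obtain ⟨F, hF, hFf⟩ := hf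
  obtain ⟨m, rfl⟩ : ∃ m : ℕ, n = -(m + 1 : ℤ) := ⟨(-n - 1).toNat, by omega⟩
  have hcauchy : (∮ z in C(0, 1), z ^ m • F z) = 0 :=
    (DiffContOnCl.smul (differentiable_id.pow m).diffContOnCl hF).circleIntegral_eq_zero zero_le_one
  have hcoeff : (∮ z in C(0, 1), z ^ m • F z) = Complex.I * ∫ t in (0 : ℝ)..(2 * π),
      Complex.exp (-(((-(m + 1 : ℤ) : ℤ) : ℂ) * t * Complex.I)) * f (Circle.exp t) := by
    rw [circleIntegral, ← intervalIntegral.integral_const_mul]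
    refine intervalIntegral.integral_congr fun t _ => ?_
    have hmap : circleMap 0 1 t = (Circle.exp t : ℂ) := by simp [circleMap]
    have hexp : Complex.exp (-(((-(m + 1 : ℤ) : ℤ) : ℂ) * t * Complex.I)) =
        (Circle.exp t : ℂ) ^ (m + 1) := by
      rw [Circle.coe_exp, ← Complex.exp_nat_mul]
      congr 1
      push_cast
      ring
    simp only [deriv_circleMap, hmap, hFf, hexp, smul_eq_mul]
    ring
  rw [hcoeff, mul_eq_zero] at hcauchy
  rw [coeff_eq_integral, hcauchy.resolve_left Complex.I_ne_zero, smul_zero]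

theorem hasSum_nat_coeff_mul_pow {f : Smooth} (h : ∀ n < 0, coeff f n = 0) (z : Circle) :
    HasSum (fun n : ℕ => coeff f n * (z : ℂ) ^ n) (f z) := by
  have hrange : ∀ n ∉ range ((↑) : ℕ → ℤ), coeff f n * (z : ℂ) ^ n = 0 := fun n hn => by
    rw [h n (by by_contra hneg; exact hn ⟨n.toNat, by simpa using hneg⟩), zero_mul]
  simpa only [Function.comp_def, zpow_natCast] using
    ((Nat.cast_injective (R := ℤ)).hasSum_iff hrange).2 (hasSum_coeff_mul_zpow f z)

theorem mem_aInf_of_coeff_eq_zero {f : Smooth} (h : ∀ n < 0, coeff f n = 0) : f ∈ aInf := by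
  have hsum : Summable fun n : ℕ => ‖coeff f n‖ :=
    (summable_norm_coeff f).comp_injective Nat.cast_injective
  have hbound (n : ℕ) {z : ℂ} (hz : ‖z‖ ≤ 1) : ‖coeff f n * z ^ n‖ ≤ ‖coeff f n‖ := by
    rw [norm_mul, norm_pow]
    exact mul_le_of_le_one_right (norm_nonneg _) (pow_le_one₀ (norm_nonneg _) hz)
  refine ⟨fun z => ∑' n : ℕ, coeff f n * z ^ n, ⟨?_, ?_⟩,
    fun z => (hasSum_nat_coeff_mul_pow h z).tsum_eq⟩
  · exact Complex.differentiableOn_tsum_of_summable_norm hsum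
      (fun n => ((differentiable_id.pow n).const_mul _).differentiableOn) Metric.isOpen_ball
      fun n z hz => hbound n (mem_ball_zero_iff.1 hz).le
  · rw [closure_ball _ one_ne_zero]
    exact continuousOn_tsum (fun n => (continuous_const.mul (continuous_id.pow n)).continuousOn)
      hsum fun n z hz => hbound n (mem_closedBall_zero_iff.1 hz)

theorem mem_aInf_iff {f : Smooth} : f ∈ aInf ↔ ∀ n < 0, coeff f n = 0 :=
  ⟨fun hf _ => coeff_eq_zero_of_mem_aInf hf, mem_aInf_of_coeff_eq_zero⟩

theorem alphaPow_mem_aInf {k : ℤ} (hk : 0 ≤ k) : alphaPow k ∈ aInf :=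
  mem_aInf_iff.2 fun n hn => by rw [coeff_alphaPow, if_neg (by omega)]

end Fourier

/-! ### The Fréchet topology of `C^∞(𝕋)` -/

section Topology

instance : PolynormableSpace ℂ Smooth := withSeminorms_rho.toPolynormableSpace

theorem rho_apply (ν : ℝ≥0) (f : Smooth) :
    rho ν f = ∑' n : ℤ, ‖coeff f n‖ * (1 + |(n : ℝ)|) ^ (ν : ℝ) := rfl

theorem continuous_rho (ν : ℝ≥0) : Continuous (rho ν) := withSeminorms_rho.continuous_seminorm ν

theorem norm_coeff_mul_le_rho (ν : ℝ≥0) (f : Smooth) (n : ℤ) :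
    ‖coeff f n‖ * (1 + |(n : ℝ)|) ^ (ν : ℝ) ≤ rho ν f :=
  (summable_rho ν f).le_tsum n fun _ _ => by positivity

theorem rho_mono {ν μ : ℝ≥0} (h : ν ≤ μ) (f : Smooth) : rho ν f ≤ rho μ f :=
  (summable_rho ν f).tsum_le_tsum (fun n => by gcongr; simp) (summable_rho μ f)

theorem norm_coeff_le_rho (ν : ℝ≥0) (f : Smooth) (n : ℤ) : ‖coeff f n‖ ≤ rho ν f := by
  refine le_trans ?_ ((norm_coeff_mul_le_rho 0 f n).trans (rho_mono zero_le f))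
  simp

theorem rho_alphaPow (ν : ℝ≥0) (n : ℤ) : rho ν (alphaPow n) = (1 + |(n : ℝ)|) ^ (ν : ℝ) := by
  rw [rho_apply, tsum_eq_single n fun m hm => by rw [coeff_alphaPow, if_neg hm]; simp]
  simp [coeff_alphaPow]

theorem norm_apply_le_rho (f : Smooth) (z : Circle) : ‖f z‖ ≤ rho 0 f := by
  have hnorm (n : ℤ) : ‖coeff f n * (z : ℂ) ^ n‖ = ‖coeff f n‖ := by
    rw [norm_mul, norm_circle_zpow, mul_one]
  rw [← (hasSum_coeff_mul_zpow f z).tsum_eq, rho_apply]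
  refine (norm_tsum_le_tsum_norm ?_).trans_eq (tsum_congr fun n => ?_)
  · simpa only [hnorm] using summable_norm_coeff f
  · rw [hnorm]
    simp

theorem rho_D_le (ν : ℝ≥0) (f : Smooth) : rho ν (D f) ≤ 2 ^ (ν : ℝ) * rho (ν + 1) f := by
  let g (n : ℤ) : ℝ := ‖coeff f n‖ * (1 + |(n : ℝ)|) ^ ((ν + 1 : ℝ≥0) : ℝ)
  have hshift : rho (ν + 1) f = ∑' n, g (n + 1) := ((Equiv.addRight (1 : ℤ)).tsum_eq g).symm
  have hsummable : Summable fun n => g (n + 1) :=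
    (Equiv.addRight (1 : ℤ)).summable_iff.2 (summable_rho (ν + 1) f)
  rw [hshift, ← tsum_mul_left, rho_apply]
  refine (summable_rho ν (D f)).tsum_le_tsum (fun n => ?_) (hsummable.mul_left _)
  have hfactor : ‖(n + 1 : ℂ)‖ ≤ 1 + |((n + 1 : ℤ) : ℝ)| := by
    rw [← Complex.norm_intCast]
    push_cast
    linarith
  have hbase : 1 + |(n : ℝ)| ≤ 2 * (1 + |((n + 1 : ℤ) : ℝ)|) := by
    have := abs_sub ((n : ℝ) + 1) 1
    rw [add_sub_cancel_right, abs_one] at this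
    push_cast
    linarith [abs_nonneg ((n : ℝ) + 1)]
  have hweight : (1 + |(n : ℝ)|) ^ (ν : ℝ) ≤
      2 ^ (ν : ℝ) * (1 + |((n + 1 : ℤ) : ℝ)|) ^ (ν : ℝ) := by
    rw [← Real.mul_rpow (by norm_num) (by positivity)]
    gcongr
  calc ‖coeff (D f) n‖ * (1 + |(n : ℝ)|) ^ (ν : ℝ)
      = ‖(n + 1 : ℂ)‖ * ‖coeff f (n + 1)‖ * (1 + |(n : ℝ)|) ^ (ν : ℝ) := by
        rw [coeff_D, norm_mul]
    _ ≤ (1 + |((n + 1 : ℤ) : ℝ)|) * ‖coeff f (n + 1)‖ *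
        (2 ^ (ν : ℝ) * (1 + |((n + 1 : ℤ) : ℝ)|) ^ (ν : ℝ)) := by gcongr
    _ = 2 ^ (ν : ℝ) * g (n + 1) := by
        simp only [g]
        rw [NNReal.coe_add, NNReal.coe_one, Real.rpow_add (by positivity), Real.rpow_one]
        ring

theorem continuous_of_norm_le_rho {T : Smooth →ₗ[ℂ] ℂ} {ν : ℝ≥0}
    (h : ∀ f, ‖T f‖ ≤ rho ν f) : Continuous T := by
  refine continuous_of_continuousAt_zero T ?_
  rw [ContinuousAt, map_zero]
  exact squeeze_zero_norm h (by simpa using (continuous_rho ν).tendsto 0)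

theorem continuous_D : Continuous D :=
  WithSeminorms.continuous_of_isBounded withSeminorms_rho withSeminorms_rho _ fun ν =>
    ⟨{ν + 1}, 2 ^ (ν : ℝ), fun f => by simpa using! rho_D_le ν f⟩

/-- The Fourier coefficient `f ↦ f̂(n)` as a distribution. -/
noncomputable def coeffL (n : ℤ) : Distribution :=
  let T : Smooth →ₗ[ℂ] ℂ :=
    ⟨⟨fun f => coeff f n, fun f g => coeff_add f g n⟩, fun c f => coeff_smul c f n⟩
  ⟨T, continuous_of_norm_le_rho (T := T) fun f => norm_coeff_le_rho 0 f n⟩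

theorem coeffL_apply (n : ℤ) (f : Smooth) : coeffL n f = coeff f n := rfl

theorem coeff_sub (f g : Smooth) (n : ℤ) : coeff (f - g : Smooth) n = coeff f n - coeff g n :=
  map_sub (coeffL n) f g

theorem coeff_zero (n : ℤ) : coeff (0 : Smooth) n = 0 := map_zero (coeffL n)

/-- Evaluation at a point of the circle as a distribution. -/
noncomputable def evalL (z : Circle) : Distribution :=
  let T : Smooth →ₗ[ℂ] ℂ := ⟨⟨fun f => f z, fun _ _ => rfl⟩, fun _ _ => rfl⟩
  ⟨T, continuous_of_norm_le_rho (T := T) fun f => norm_apply_le_rho f z⟩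

theorem isClosed_aInf : IsClosed (aInf : Set Smooth) := by
  have h : (aInf : Set Smooth) = ⋂ n < 0, {f : Smooth | coeffL n f = 0} := by
    ext f
    simp only [SetLike.mem_coe, mem_aInf_iff, mem_iInter, mem_ofPred_eq, coeffL_apply]
  rw [h]
  exact isClosed_biInter fun n _ => isClosed_eq (coeffL n).continuous continuous_const

theorem isClosed_idealInf (E : Set Circle) : IsClosed (idealInf E : Set Smooth) := by
  have h : (idealInf E : Set Smooth) =
      ⋂ (i : ℕ), ⋂ z ∈ E, {f : Smooth | evalL z ((D ^ i) f) = 0} := by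
    ext f
    simp only [mem_iInter, mem_ofPred_eq]
    rfl
  have hD (i : ℕ) : Continuous (D ^ i : Smooth →ₗ[ℂ] Smooth) := by
    rw [Module.End.coe_pow]
    exact continuous_D.iterate i
  rw [h]
  exact isClosed_iInter fun i => isClosed_biInter fun z _ =>
    isClosed_eq ((evalL z).continuous.comp (hD i)) continuous_const

theorem tendsto_iff_rho {ι : Type*} {l : Filter ι} {u : ι → Smooth} {f : Smooth} :
    Tendsto u l (𝓝 f) ↔ ∀ ν : ℝ≥0, Tendsto (fun i => rho ν (u i - f)) l (𝓝 0) := by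
  rw [withSeminorms_rho.tendsto_nhds]
  refine forall_congr' fun ν => ?_
  rw [Metric.tendsto_nhds]
  simp only [dist_zero_right, Real.norm_of_nonneg (apply_nonneg (rho ν) _)]

instance : FirstCountableTopology Smooth :=
  have : WithSeminorms fun k : ℕ => rho k :=
    withSeminorms_rho.congr (fun k => ⟨{(k : ℝ≥0)}, 1, fun f => by simp⟩)
      fun ν => ⟨{⌈ν⌉₊}, 1, fun f => by simpa using rho_mono (Nat.le_ceil ν) f⟩
  this.firstCountableTopology

instance : T1Space Smooth :=
  withSeminorms_rho.T1_of_separating fun f hf => ⟨0, fun h => hf <| Smooth.ext_coeff fun n => by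
    rw [coeff_zero]
    exact norm_le_zero_iff.1 (h ▸ norm_coeff_le_rho 0 f n)⟩

noncomputable instance : UniformSpace Smooth := IsTopologicalAddGroup.rightUniformSpace Smooth

instance : IsUniformAddGroup Smooth := isUniformAddGroup_of_addCommGroup

instance : (uniformity Smooth).IsCountablyGenerated :=
  IsUniformAddGroup.uniformity_countably_generated

theorem exists_rho_sub_le_of_cauchySeq {u : ℕ → Smooth} (hu : CauchySeq u) (ν : ℝ≥0) {ε : ℝ}
    (hε : 0 < ε) : ∃ N, ∀ m ≥ N, ∀ n ≥ N, rho ν (u m - u n) ≤ ε := by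
  have hsub : Tendsto (fun p : ℕ × ℕ => u p.2 - u p.1) atTop (𝓝 0) := by
    rw [cauchySeq_iff_tendsto, uniformity_eq_comap_nhds_zero, tendsto_comap_iff] at hu
    exact hu
  have hrho := ((continuous_rho ν).tendsto 0).comp hsub
  rw [map_zero] at hrho
  obtain ⟨⟨a, b⟩, hab⟩ := eventually_atTop.1 (hrho.eventually (eventually_le_nhds hε))
  exact ⟨max a b, fun m hm n hn => hab (n, m)
    ⟨(le_max_left a b).trans hn, (le_max_right a b).trans hm⟩⟩

theorem sum_norm_coeff_sub_le {u : ℕ → Smooth} {c : ℤ → ℂ}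
    (hc : ∀ j, Tendsto (fun n => coeff (u n) j) atTop (𝓝 (c j))) {ν : ℝ≥0} {ε : ℝ} {f : Smooth}
    (hf : ∀ᶠ n in atTop, rho ν (f - u n) ≤ ε) (S : Finset ℤ) :
    ∑ j ∈ S, ‖coeff f j - c j‖ * (1 + |(j : ℝ)|) ^ (ν : ℝ) ≤ ε := by
  have htendsto : Tendsto (fun n => ∑ j ∈ S, ‖coeff f j - coeff (u n) j‖ *
      (1 + |(j : ℝ)|) ^ (ν : ℝ)) atTop
      (𝓝 (∑ j ∈ S, ‖coeff f j - c j‖ * (1 + |(j : ℝ)|) ^ (ν : ℝ))) :=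
    tendsto_finsetSum _ fun j _ => (tendsto_const_nhds.sub (hc j)).norm.mul_const _
  refine le_of_tendsto htendsto (hf.mono fun n hn => le_trans ?_ hn)
  simp only [← coeff_sub]
  exact (summable_rho ν _).sum_le_tsum S fun _ _ => by positivity

theorem summable_of_sum_norm_coeff_sub_le {c : ℤ → ℂ} {ν : ℝ≥0} {ε : ℝ} {f : Smooth}
    (h : ∀ S : Finset ℤ, ∑ j ∈ S, ‖coeff f j - c j‖ * (1 + |(j : ℝ)|) ^ (ν : ℝ) ≤ ε) :
    Summable fun j : ℤ => ‖c j‖ * (1 + |(j : ℝ)|) ^ (ν : ℝ) := by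
  refine ((summable_of_sum_le (fun j => by positivity) h).add (summable_rho ν f)).of_nonneg_of_le
    (fun j => by positivity) fun j => ?_
  rw [← add_mul]
  gcongr
  simpa [add_comm] using norm_sub_le (coeff f j) (coeff f j - c j)

instance : CompleteSpace Smooth := by
  refine UniformSpace.complete_of_cauchySeq_tendsto fun u hu => ?_
  have hcoeff (j : ℤ) : ∃ c, Tendsto (fun n => coeff (u n) j) atTop (𝓝 c) :=
    cauchySeq_tendsto_of_complete (hu.map (coeffL j).uniformContinuous)
  choose c hc using hcoeff
  have hsum (ν : ℝ≥0) {ε : ℝ} (hε : 0 < ε) : ∃ N, ∀ m ≥ N, ∀ S : Finset ℤ,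
      ∑ j ∈ S, ‖coeff (u m) j - c j‖ * (1 + |(j : ℝ)|) ^ (ν : ℝ) ≤ ε := by
    obtain ⟨N, hN⟩ := exists_rho_sub_le_of_cauchySeq hu ν hε
    exact ⟨N, fun m hm => sum_norm_coeff_sub_le hc <|
      (eventually_ge_atTop N).mono fun n hn => hN m hm n hn⟩
  obtain ⟨f, hf⟩ := exists_smooth_of_summable (c := c) fun k => by
    obtain ⟨N, hN⟩ := hsum k one_pos
    simpa using summable_of_sum_norm_coeff_sub_le (hN N le_rfl)
  refine ⟨f, tendsto_iff_rho.2 fun ν => Metric.tendsto_atTop.2 fun ε hε => ?_⟩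
  obtain ⟨N, hN⟩ := hsum ν (half_pos hε)
  refine ⟨N, fun m hm => ?_⟩
  rw [dist_zero_right, Real.norm_of_nonneg (apply_nonneg _ _)]
  refine lt_of_le_of_lt ?_ (half_lt_self hε)
  refine (summable_rho ν _).tsum_le_of_sum_le fun S => ?_
  simpa only [coeff_sub, hf] using hN m hm S

theorem exists_le_mul_rho {p : Seminorm ℂ Smooth} (hp : Continuous p) :
    ∃ C > 0, ∃ ν : ℝ≥0, ∀ f, p f ≤ C * rho ν f := by
  obtain ⟨s, C, -, hC⟩ := Seminorm.bound_of_continuous withSeminorms_rho p hp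
  refine ⟨C + 1, by positivity, s.sup id, fun f => (hC f).trans ?_⟩
  have hsup : s.sup rho f ≤ rho (s.sup id) f := by
    refine Seminorm.finset_sup_apply_le (apply_nonneg _ _) fun ν hν => ?_
    exact rho_mono (Finset.le_sup (f := id) hν) f
  change (C : ℝ) * s.sup rho f ≤ (C + 1) * rho (s.sup id) f
  gcongr
  simp

end Topology

section Distributions

theorem hasSum_coeff_smul_alphaPow (f : Smooth) :
    HasSum (fun n : ℤ => coeff f n • alphaPow n) f := by
  have hcoeff (S : Finset ℤ) (m : ℤ) :
      coeff (∑ n ∈ S, coeff f n • alphaPow n : Smooth) m = if m ∈ S then coeff f m else 0 := by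
    rw [← coeffL_apply, map_sum]
    simp [coeffL_apply, coeff_alphaPow]
  refine tendsto_iff_rho.2 fun ν => ?_
  let a (n : ℤ) : ℝ := ‖coeff f n‖ * (1 + |(n : ℝ)|) ^ (ν : ℝ)
  refine (tendsto_tsum_compl_atTop_zero a).congr fun S => ?_
  rw [rho_apply]
  refine (tsum_subtype {n | n ∉ S} a).trans (tsum_congr fun n => ?_)
  rw [coeff_sub, hcoeff]
  by_cases h : n ∈ S <;> simp [a, h]

theorem hasSum_coeff_mul_distribution (T : Distribution) (f : Smooth) :
    HasSum (fun n : ℤ => coeff f n * T (alphaPow n)) (T f) := by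
  simpa using! T.hasSum (hasSum_coeff_smul_alphaPow f)

theorem distribution_ext {S T : Distribution} (h : ∀ n, S (alphaPow n) = T (alphaPow n)) : S = T :=
  ContinuousLinearMap.ext fun f => (hasSum_coeff_mul_distribution S f).unique <| by
    simpa only [h] using hasSum_coeff_mul_distribution T f

end Distributions

/-! ### Distributions vanishing on `a^∞` and on `I_∞(E)` -/

section Uniqueness

theorem exists_forall_eq_zero_of_prod_eq_zero {ι : Type*} {U : Set ℂ} (hU : IsPreconnected U)
    (hne : U.Nonempty) (S : Finset ι) {F : ι → ℂ → ℂ} (hF : ∀ i ∈ S, AnalyticOnNhd ℂ (F i) U)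
    (h : ∀ z ∈ U, ∏ i ∈ S, F i z = 0) : ∃ i ∈ S, ∀ z ∈ U, F i z = 0 := by
  classical
  induction S using Finset.induction_on with
  | empty =>
    obtain ⟨z, hz⟩ := hne
    simpa using h z hz
  | insert a S ha ih =>
    simp only [Finset.prod_insert ha] at h
    have hFS : ∀ i ∈ S, AnalyticOnNhd ℂ (F i) U := fun i hi => hF i (Finset.mem_insert_of_mem hi)
    rcases (hF a (Finset.mem_insert_self a S)).eq_zero_or_eq_zero_of_mul_eq_zero
      (Finset.analyticOnNhd_fun_prod S hFS) h hU with ha0 | hS0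
    · exact ⟨a, Finset.mem_insert_self a S, ha0⟩
    · obtain ⟨i, hi, hi0⟩ := ih hFS hS0
      exact ⟨i, Finset.mem_insert_of_mem hi, hi0⟩

theorem diffContOnCl_rotate {F : ℂ → ℂ} (hF : DiffContOnCl ℂ F (Metric.ball 0 1)) (u : Circle) :
    DiffContOnCl ℂ (fun z : ℂ => F (u * z)) (Metric.ball 0 1) :=
  hF.comp (differentiable_id.const_mul (u : ℂ)).diffContOnCl fun z hz => by
    simpa [Circle.norm_coe u] using hz

/-- Finitely many rotates of the arc cover the circle, so the product of the corresponding rotates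
of `F` vanishes on the circle, hence in the disc, hence one of its factors does. -/
theorem eqOn_zero_of_eq_zero_on_arc {F : ℂ → ℂ} (hF : DiffContOnCl ℂ F (Metric.ball 0 1))
    {V : Set Circle} (hV : IsOpen V) (hne : V.Nonempty) (h : ∀ z ∈ V, F z = 0) :
    EqOn F 0 (Metric.closedBall 0 1) := by
  obtain ⟨S, hS⟩ := compact_covered_by_mul_left_translates isCompact_univ
    (show (interior V).Nonempty by rwa [hV.interior_eq])
  have hprod : DiffContOnCl ℂ (fun z : ℂ => ∏ u ∈ S, F (u * z)) (Metric.ball 0 1) :=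
    ⟨.fun_finsetProd fun u _ => (diffContOnCl_rotate hF u).differentiableOn,
      continuousOn_finsetProd _ fun u _ => (diffContOnCl_rotate hF u).continuousOn⟩
  have hzero : ∀ z ∈ Metric.ball (0 : ℂ) 1, ∏ u ∈ S, F (u * z) = 0 := fun z hz => by
    refine Complex.eqOn_of_eqOn_frontier Metric.isBounded_ball hprod
      (g := fun _ => 0) diffContOnCl_const (fun z hz => ?_) hz
    rw [frontier_ball _ one_ne_zero] at hz
    let ζ : Circle := ⟨z, hz⟩
    obtain ⟨u, hu, huζ⟩ := mem_iUnion₂.1 (hS (mem_univ ζ))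
    exact Finset.prod_eq_zero hu (by simpa [ζ] using! h _ huζ)
  obtain ⟨u, -, hu⟩ := exists_forall_eq_zero_of_prod_eq_zero
    (convex_ball (0 : ℂ) 1).isPreconnected ⟨0, by simp⟩ S
    (fun u _ => (diffContOnCl_rotate hF u).differentiableOn.analyticOnNhd Metric.isOpen_ball) hzero
  have hball : EqOn F 0 (Metric.ball 0 1) := fun z hz => by
    simpa [← mul_assoc] using hu ((u⁻¹ : Circle) * z) (by simpa [Circle.norm_coe u] using hz)
  rw [← closure_ball _ one_ne_zero]
  exact hball.of_subset_closure hF.continuousOn continuousOn_const subset_closure subset_rfl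

theorem eq_zero_of_mem_aInf_of_eq_zero_on_arc {f : Smooth} (hf : f ∈ aInf) {V : Set Circle}
    (hV : IsOpen V) (hne : V.Nonempty) (h : ∀ z ∈ V, f z = 0) : f = 0 := by
  obtain ⟨F, hF, hFf⟩ := hf
  refine Smooth.ext fun z => ?_
  rw [← hFf, Smooth.zero_apply]
  exact eqOn_zero_of_eq_zero_on_arc hF hV hne (fun z hz => (hFf z).trans (h z hz))
    (mem_closedBall_zero_iff.2 (Circle.norm_coe z).le)

theorem eventually_D_eq_zero {f : Smooth} {z : Circle} (h : ∀ᶠ w in 𝓝 z, f w = 0) :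
    ∀ᶠ w in 𝓝 z, D f w = 0 := by
  refine h.eventually_nhds.mono fun w hw => ?_
  have hlim : Tendsto (fun t : ℝ => w * Circle.exp t) (𝓝 0) (𝓝 w) :=
    Continuous.tendsto' (by fun_prop) _ _ (by simp)
  have hzero : (fun t : ℝ => f (w * Circle.exp t)) =ᶠ[𝓝 0] fun _ => 0 := hlim.eventually hw
  rw [D_apply, circleDeriv, hzero.deriv_eq, deriv_const, zero_div]

theorem mem_idealInf_of_eventually_eq_zero {E : Set Circle} {f : Smooth}
    (h : ∀ z ∈ E, ∀ᶠ w in 𝓝 z, f w = 0) : f ∈ idealInf E := fun i z hz => by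
  have hi : ∀ᶠ w in 𝓝 z, (D ^ i) f w = 0 := by
    induction i with
    | zero => exact h z hz
    | succ i ih =>
      rw [pow_succ', Module.End.mul_apply]
      exact eventually_D_eq_zero ih
  exact hi.self_of_nhds

theorem exists_smooth_eq_zero_off_ball {r : ℝ} (hr : 0 < r) (m : ℤ) :
    ∃ φ : Smooth, (∀ z : Circle, r ≤ dist z 1 → φ z = 0) ∧ coeff φ m ≠ 0 := by
  obtain ⟨β, hsupp, hβ, hnonneg⟩ :=
    (Metric.isOpen_ball (x := (1 : Circle)) (ε := r)).exists_contMDiff_support_eq (𝓡 1)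
  have hsmooth : ContMDiff (𝓡 1) 𝓘(ℝ, ℂ) ∞ fun z : Circle => β z • (z : ℂ) ^ m :=
    hβ.smul (alphaPow m).contMDiff
  refine ⟨⟨_, hsmooth⟩, fun z hz => ?_, ?_⟩
  · have hβz : β z = 0 := by
      rw [← Function.notMem_support, hsupp, Metric.mem_ball, not_lt]
      exact hz
    change β z • (z : ℂ) ^ m = 0
    rw [hβz, zero_smul]
  · have hβ1 : 0 < β (Circle.exp 0) := by
      refine (hnonneg _).lt_of_ne' (Function.mem_support.1 ?_)
      rw [hsupp, Circle.exp_zero]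
      exact Metric.mem_ball_self hr
    have hint : 0 < ∫ t in (0 : ℝ)..(2 * π), β (Circle.exp t) :=
      intervalIntegral.integral_pos Real.two_pi_pos
        (hβ.continuous.comp Circle.exp.continuous).continuousOn (fun t _ => hnonneg _)
        ⟨0, ⟨le_rfl, Real.two_pi_pos.le⟩, hβ1⟩
    have hintegrand (t : ℝ) : Complex.exp (-(m * t * Complex.I)) *
        (β (Circle.exp t) • (Circle.exp t : ℂ) ^ m) = (β (Circle.exp t) : ℂ) := by
      rw [Circle.coe_exp, ← Complex.exp_int_mul, mul_smul_comm, ← mul_assoc, ← Complex.exp_add,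
        neg_add_cancel, Complex.exp_zero, Complex.real_smul, mul_one]
    change coeff (fun z => β z • (z : ℂ) ^ m) m ≠ 0
    simp only [coeff_eq_integral, hintegrand, intervalIntegral.integral_ofReal]
    exact smul_ne_zero (by positivity) (by exact_mod_cast hint.ne')

/-- The function `ζ ↦ φ (w / ζ)`, on which a distribution takes the value at `w` of its convolution
with `φ`. -/
noncomputable def reflectTranslate (φ : Smooth) (w : Circle) : Smooth :=
  ⟨fun ζ => φ (w / ζ), φ.contMDiff.comp (contMDiff_const.div contMDiff_id)⟩

theorem reflectTranslate_apply (φ : Smooth) (w ζ : Circle) :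
    reflectTranslate φ w ζ = φ (w / ζ) := rfl

theorem coeff_reflectTranslate (φ : Smooth) (w : Circle) (n : ℤ) :
    coeff (reflectTranslate φ w) n = coeff φ (-n) * (w : ℂ) ^ (-n) := by
  refine coeff_of_hasSum (c := fun n => coeff φ (-n) * (w : ℂ) ^ (-n)) ?_ (fun ζ => ?_) n
  · simp only [norm_mul, norm_circle_zpow, mul_one]
    exact (Equiv.neg ℤ).summable_iff.2 (summable_norm_coeff φ)
  · refine ((Equiv.neg ℤ).hasSum_iff.2 (hasSum_coeff_mul_zpow φ (w / ζ))).congr_fun fun n => ?_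
    simp only [Function.comp_apply, Equiv.neg_apply, Circle.coe_div, div_zpow, zpow_neg,
      div_inv_eq_mul]
    ring

theorem exists_smooth_convolution (T : Distribution) (φ : Smooth) :
    ∃ g : Smooth, (∀ n, coeff g n = coeff φ n * distCoeff T n) ∧
      ∀ w, g w = T (reflectTranslate φ w) := by
  obtain ⟨C, -, ν, hT⟩ := exists_le_mul_rho (p := (normSeminorm ℂ ℂ).comp T.toLinearMap)
    T.continuous.norm
  have hsummable (k : ℕ) :
      Summable fun n : ℤ => ‖coeff φ n * distCoeff T n‖ * (1 + |(n : ℝ)|) ^ k := by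
    refine .of_nonneg_of_le (fun n => by positivity) (fun n => ?_)
      ((summable_rho (ν + k) φ).mul_left C)
    have hTn : ‖distCoeff T n‖ ≤ C * (1 + |(n : ℝ)|) ^ (ν : ℝ) := by
      simpa [rho_alphaPow] using! hT (alphaPow (-n))
    rw [norm_mul, NNReal.coe_add, NNReal.coe_natCast, Real.rpow_add (by positivity),
      Real.rpow_natCast]
    calc ‖coeff φ n‖ * ‖distCoeff T n‖ * (1 + |(n : ℝ)|) ^ k
        ≤ ‖coeff φ n‖ * (C * (1 + |(n : ℝ)|) ^ (ν : ℝ)) * (1 + |(n : ℝ)|) ^ k := by gcongr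
      _ = C * (‖coeff φ n‖ * ((1 + |(n : ℝ)|) ^ (ν : ℝ) * (1 + |(n : ℝ)|) ^ k)) := by ring
  obtain ⟨g, hg⟩ := exists_smooth_of_summable hsummable
  refine ⟨g, hg, fun w => (hasSum_coeff_mul_zpow g w).unique ?_⟩
  refine ((Equiv.neg ℤ).hasSum_iff.2
    (hasSum_coeff_mul_distribution T (reflectTranslate φ w))).congr_fun fun n => ?_
  simp only [hg, coeff_reflectTranslate, distCoeff, Function.comp_apply, Equiv.neg_apply, neg_neg]
  ring

theorem eventually_reflectTranslate_eq_zero {φ : Smooth} {r : ℝ}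
    (hφ : ∀ z : Circle, r ≤ dist z 1 → φ z = 0) {w z : Circle} (h : r < dist w z) :
    ∀ᶠ ζ in 𝓝 z, reflectTranslate φ w ζ = 0 := by
  have hdist (ζ : Circle) : dist (w / ζ) 1 = dist w ζ := by
    have h : ‖((w / ζ : Circle) : ℂ) - (1 : Circle)‖ = ‖(w : ℂ) - ζ‖ := by
      rw [Circle.coe_div, Circle.coe_one, div_sub_one (Circle.coe_ne_zero ζ), norm_div,
        Circle.norm_coe, div_one]
    rwa [← dist_eq_norm, ← dist_eq_norm] at h
  have hcont : Continuous fun ζ : Circle => dist w ζ := by fun_prop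
  filter_upwards [hcont.continuousAt.eventually (lt_mem_nhds h)] with ζ hζ
  rw [reflectTranslate_apply]
  exact hφ _ ((hdist ζ).symm ▸ hζ.le)

/-- Off `E`, near a point `w₀`, the convolution of `T` with a function supported close to `1` is
zero because `T` kills `I_∞(E)`; it belongs to `a^∞` because `T` kills `a^∞`. Hence it vanishes. -/
theorem eq_zero_of_mem_annihilators {E : Set Circle} (hE : ¬Dense E) {T : Distribution}
    (hTE : T ∈ annihilator (idealInf E)) (hTA : T ∈ annihilator aInf) : T = 0 := by
  obtain ⟨w₀, r, hr, hball⟩ : ∃ w₀, ∃ r > 0, ∀ z, dist z w₀ < r → z ∉ E := by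
    simpa [Metric.dense_iff, Set.Nonempty] using hE
  refine distribution_ext fun m => ?_
  rw [_root_.zero_apply]
  obtain ⟨φ, hφ, hφm⟩ := exists_smooth_eq_zero_off_ball (half_pos hr) (-m)
  obtain ⟨g, hg, hgT⟩ := exists_smooth_convolution T φ
  have hgA : g ∈ aInf := mem_aInf_iff.2 fun n hn => by
    rw [hg, distCoeff, hTA _ (alphaPow_mem_aInf (by omega)), mul_zero]
  have hg_arc : ∀ w ∈ Metric.ball w₀ (r / 2), g w = 0 := fun w hw => by
    rw [hgT]
    refine hTE _ (mem_idealInf_of_eventually_eq_zero fun z hz => ?_)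
    refine eventually_reflectTranslate_eq_zero hφ ?_
    have hzr : r ≤ dist z w₀ := not_lt.1 fun hlt => hball z hlt hz
    linarith [dist_triangle_left z w₀ w, Metric.mem_ball.1 hw]
  have hg0 : g = 0 := eq_zero_of_mem_aInf_of_eq_zero_on_arc hgA Metric.isOpen_ball
    ⟨w₀, Metric.mem_ball_self (half_pos hr)⟩ hg_arc
  have hgm := hg (-m)
  rw [hg0, coeff_zero, distCoeff, neg_neg] at hgm
  exact (mul_eq_zero.1 hgm.symm).resolve_left hφm

end Uniqueness

/-! ### Interpolation sets -/

section Interpolation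

theorem isInterpolationSet_iff_sup_eq_top {E : Set Circle} :
    IsInterpolationSet E ↔ aInf ⊔ idealInf E = ⊤ := by
  simp only [Submodule.eq_top_iff', Submodule.mem_sup]
  refine forall_congr' fun f => exists_congr fun g => and_congr_right fun _ => ?_
  constructor
  · intro h
    refine ⟨f - g, fun i z hz => ?_, add_sub_cancel g f⟩
    change evalL z ((D ^ i) (f - g)) = 0
    rw [map_sub, map_sub, sub_eq_zero]
    exact h i z hz
  · rintro ⟨k, hk, rfl⟩ i z hz
    rw [map_add, Smooth.add_apply, hk i z hz, add_zero]

theorem annihilatorSplits_iff {E : Set Circle} :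
    AnnihilatorSplits E ↔ ∀ T : Distribution, (∀ f ∈ aInf ⊓ idealInf E, T f = 0) →
      ∃ R S : Distribution,
        (∀ f ∈ aInf, R f = 0) ∧ (∀ f ∈ idealInf E, S f = 0) ∧ R + S = T := by
  have hle : annihilator (idealInf E) ⊔ annihilator aInf ≤ annihilator (idealInfPlus E) :=
    sup_le (fun T hT f hf => hT f hf.1) (fun T hT f hf => hT f hf.2)
  rw [AnnihilatorSplits, ← hle.ge_iff_eq', sup_comm, SetLike.le_def, idealInfPlus, inf_comm]
  simp only [Submodule.mem_sup, exists_and_left]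
  rfl

theorem norm_apply_le_mul_rho {T : Distribution} {M : ℝ} {s : ℝ≥0} {f : Smooth}
    (h : ∀ n, coeff f n ≠ 0 → ‖T (alphaPow n)‖ ≤ M * (1 + |(n : ℝ)|) ^ (s : ℝ)) :
    ‖T f‖ ≤ M * rho s f := by
  rw [← (hasSum_coeff_mul_distribution T f).tsum_eq]
  refine tsum_of_norm_bounded ((summable_rho s f).hasSum.mul_left M) fun n => ?_
  rcases eq_or_ne (coeff f n) 0 with hn | hn
  · simp [hn]
  · rw [norm_mul, mul_left_comm]
    gcongr
    exact h n hn

theorem iSup_distCoeff_le_iff {T : Distribution} {M : ℝ} (hM : 0 ≤ M) {t : ℝ≥0} :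
    (⨆ n : ℤ, ENNReal.ofReal (‖distCoeff T n‖ / (1 + |(n : ℝ)|) ^ (t : ℝ))) ≤ ENNReal.ofReal M ↔
      ∀ f, ‖T f‖ ≤ M * rho t f := by
  simp only [iSup_le_iff, ENNReal.ofReal_le_ofReal_iff hM]
  constructor
  · refine fun h f => norm_apply_le_mul_rho fun n _ => ?_
    rw [← div_le_iff₀ (by positivity)]
    simpa [distCoeff] using h (-n)
  · intro h n
    rw [div_le_iff₀ (by positivity)]
    simpa [distCoeff, rho_alphaPow] using h (alphaPow (-n))

theorem iSup_nonpos_distCoeff_le_iff {T : Distribution} {M : ℝ} (hM : 0 ≤ M) {s : ℝ≥0} :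
    (⨆ (n : ℤ) (_ : n ≤ 0), ENNReal.ofReal (‖distCoeff T n‖ / (1 + |(n : ℝ)|) ^ (s : ℝ))) ≤
      ENNReal.ofReal M ↔ ∀ f ∈ aInf, ‖T f‖ ≤ M * rho s f := by
  simp only [iSup_le_iff, ENNReal.ofReal_le_ofReal_iff hM]
  constructor
  · refine fun h f hf => norm_apply_le_mul_rho fun n hn => ?_
    have hn0 : 0 ≤ n := not_lt.1 fun hlt => hn (mem_aInf_iff.1 hf n hlt)
    rw [← div_le_iff₀ (by positivity)]
    simpa [distCoeff] using h (-n) (neg_nonpos.2 hn0)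
  · intro h n hn
    rw [div_le_iff₀ (by positivity)]
    simpa [distCoeff, rho_alphaPow] using h (alphaPow (-n)) (alphaPow_mem_aInf (neg_nonneg.2 hn))

theorem CoeffEstimate.normsAnnihilator {E : Set Circle} (h : CoeffEstimate E) :
    NormsAnnihilator aInf (idealInf E) := by
  intro p hp
  obtain ⟨M, hM, s, hps⟩ := exists_le_mul_rho hp
  obtain ⟨C, hC, t, ht, hT⟩ := h s s.2
  lift t to ℝ≥0 using ht
  refine ⟨(C * M).toNNReal • rho t, (continuous_rho t).const_smul _, fun T hTE hTA f => ?_⟩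
  have hsup := (hT T hTE).trans <| mul_le_mul_right
    ((iSup_nonpos_distCoeff_le_iff hM.le).2 fun a ha => (hTA a ha).trans (hps a)) _
  rw [← ENNReal.ofReal_mul hC.le, iSup_distCoeff_le_iff (by positivity)] at hsup
  refine (hsup f).trans ?_
  change C * M * rho t f ≤ (C * M).toNNReal * rho t f
  rw [Real.coe_toNNReal _ (by positivity)]

theorem CoeffEstimate.of_normsAnnihilator {E : Set Circle}
    (h : NormsAnnihilator aInf (idealInf E)) : CoeffEstimate E := by
  intro s hs
  lift s to ℝ≥0 using hs
  obtain ⟨q, hq, hTq⟩ := h (rho s) (continuous_rho s)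
  obtain ⟨C, hC, t, hqt⟩ := exists_le_mul_rho hq
  refine ⟨C, hC, t, t.2, fun T hT => ?_⟩
  have hCpos : 0 < ENNReal.ofReal C := ENNReal.ofReal_pos.2 hC
  refine ENNReal.le_mul_of_forall_lt (.inl hCpos.ne') (.inl ENNReal.ofReal_ne_top)
    fun a ha b hb => ?_
  rcases eq_or_ne b ⊤ with rfl | hbtop
  · simp [(hCpos.trans ha).ne']
  obtain ⟨r, hr, rfl⟩ : ∃ r > 0, ENNReal.ofReal r = b :=
    ⟨b.toReal, ENNReal.toReal_pos hb.ne_bot hbtop, ENNReal.ofReal_toReal hbtop⟩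
  have hTr : ∀ f ∈ aInf, ‖T f‖ ≤ r * rho s f := (iSup_nonpos_distCoeff_le_iff hr.le).1 hb.le
  have hnorm (f : Smooth) : ‖((r : ℂ)⁻¹ • T) f‖ = r⁻¹ * ‖T f‖ := by
    rw [_root_.smul_apply, norm_smul, norm_inv, Complex.norm_of_nonneg hr.le]
  have hscaled := hTq ((r : ℂ)⁻¹ • T) ((annihilator _).smul_mem _ hT) fun f hf => by
    rw [hnorm, inv_mul_le_iff₀ hr]
    exact hTr f hf
  refine le_trans ?_ (mul_le_mul_left ha.le _)
  rw [← ENNReal.ofReal_mul hC.le, iSup_distCoeff_le_iff (by positivity)]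
  intro f
  have hf := (hscaled f).trans (hqt f)
  rw [hnorm, inv_mul_le_iff₀ hr] at hf
  linarith

theorem dense_aInf_sup_idealInf {E : Set Circle} (hE : ¬Dense E) :
    Dense ((aInf ⊔ idealInf E : Submodule ℂ Smooth) : Set Smooth) :=
  dense_of_forall_dual_eq_zero fun _ hT => eq_zero_of_mem_annihilators hE
    (fun f hf => hT f (Submodule.mem_sup_right hf)) fun f hf => hT f (Submodule.mem_sup_left hf)

end Interpolation

end CircleInterp

open CircleInterp in
theorem proposition4p2_general (E : Set Circle) :
    (IsInterpolationSet E ↔ CoeffEstimate E) ∧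
    (IsInterpolationSet E → AnnihilatorSplits E) ∧
    (¬Dense E → AnnihilatorSplits E → IsInterpolationSet E) := by
  rw [isInterpolationSet_iff_sup_eq_top, annihilatorSplits_iff]
  refine ⟨?_, fun h _ => exists_add_eq_of_sup_eq_top isClosed_aInf (isClosed_idealInf E) h,
    fun hE => sup_eq_top_of_forall_exists_add_eq isClosed_aInf (isClosed_idealInf E) <|
      dense_aInf_sup_idealInf hE⟩
  rw [sup_eq_top_iff_normsAnnihilator isClosed_aInf (isClosed_idealInf E)]
  exact ⟨.of_normsAnnihilator, fun h => h.normsAnnihilator⟩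

theorem proposition4p2 (E : Set Circle) (hE : IsClosed E) :
    (CircleInterp.IsInterpolationSet E ↔ CircleInterp.CoeffEstimate E) ∧
    (CircleInterp.IsInterpolationSet E → CircleInterp.AnnihilatorSplits E) ∧
    (E ≠ Set.univ →
      (CircleInterp.AnnihilatorSplits E → CircleInterp.IsInterpolationSet E)) := by
  simpa only [dense_iff_closure_eq, hE.closure_eq] using proposition4p2_general E
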